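/- **Setting.** Fix $d$ and a finite set of labelled prototiles. Each prototile is a (not necessarily convex) $d$-dimensional polyhedron in $\mathbb R^d$: a topological ball with a finite decomposition into cells (vertices, edges, 2-cells, ..., the polyhedron itself), in which every closed $k$-cell is a topological $k$-ball lying in a $k$-dimensional affine subspace, the relative boundary of each cell is a union of smaller cells, and distinct cells have disjoint relative interiors. A tiling is a covering of $\mathbb R^d$ by translates of prototiles, with disjoint interiors, that meet full-face to full-face. In the tiling topology two tilings are close if they agree on a large ball around the origin up to a small translation. Let $\mathcal T$ be a minimal tiling space: a nonempty, closed, translation-invariant set of such tilings in which every translation orbit is dense. **The approximants.** A $0$-times collared tile is a tile; a $(k+1)$-times collared tile is a tile labelled by the patch of all $k$-times collared tiles that touch it. $\Gamma^{(k)}$ is the cell complex obtained from the disjoint union of the translation classes of $k$-times collared tiles occurring in $\mathcal T$ by identifying cells that coincide somewhere in a tiling of $\mathcal T$; put $\Gamma=\Gamma^{(0)}$. Forgetting collars gives maps $\Gamma^{(k+1)}\to\Gamma^{(k)}$ with inverse limit $\mathcal T$, and the Čech cohomology is $H^1(\mathcal T,\mathbb R^d)=\varinjlim_k H^1(\Gamma^{(k)},\mathbb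 R^d)$ (cellular cohomology). **Shape functions.** A cocycle $f\in C^1(\Gamma,\mathbb R^d)$ is an admissible shape function for $\mathcal T$ if there are polyhedra with the same cell structure as the prototiles whose edge vectors are given by $f$, and, for every $x\in\mathcal T$, translates of these polyhedra form a tiling of $\mathbb R^d$ with the same combinatorics as $x$ (the tiles correspond, with the same labels, and cells of tiles coincide exactly where the corresponding cells of tiles of $x$ do). Let $\mathcal T_f$ be the space of all tilings by translates of these deformed prototiles that have the same combinatorics as some tiling in $\mathcal T$, with the tiling topology and the translation action of $\mathbb R^d$. Let $\mathcal I(f)\in H^1(\mathcal T,\mathbb R^d)$ be the pullback of $[f]\in H^1(\Gamma,\mathbb R^d)$. **Asymptotic negligibility.** A recurrence in $x\in\mathcal T$ is a pair $(\mathbf z_1,\mathbf z_2)$ of vertices of $x$ around which $x$ agrees on balls, up to translation by $\mathbf z_2-\mathbf z_1$; its size is the supremum of the radii of such balls. Recurrences of sufficiently large size give, via edge paths in $x$ from $\mathbf z_1$ to $\mathbf z_2$, closed loops in $\Gamma^{(k)}$, on which classes in $H^1(\Gamma^{(k)},\mathbb R^d)$ can be evaluated. A class $\eta\in H^1(\Gamma^{(k)},\mathbb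 R^d)$ is asymptotically negligible if for every $\epsilon>0$ there is $R_\epsilon$ such that the value of $\eta$ on every recurrence of size greater than $R_\epsilon$ has norm less than $\epsilon$. A class in $H^1(\mathcal T,\mathbb R^d)$ is asymptotically negligible if it is the pullback of an asymptotically negligible class in $H^1(\Gamma^{(k)},\mathbb R^d)$ for some finite $k$. **Theorem.** Let $f,g\in C^1(\Gamma,\mathbb R^d)$ be admissible shape functions for $\mathcal T$. If $\mathcal I(f)-\mathcal I(g)$ is asymptotically negligible, then $\mathcal T_f$ and $\mathcal T_g$ are topologically conjugate: there is a homeomorphism $\phi:\mathcal T_f\to\mathcal T_g$ with $\phi(y+\mathbf z)=\phi(y)+\mathbf z$ for all $y\in\mathcal T_f$ and $\mathbf z\in\mathbb R^d$. -/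

import Mathlib

open scoped Pointwise NNReal ENNReal

namespace TilingDeformation

/-- Euclidean space `ℝ^d`. -/
abbrev E (d : ℕ) : Type := EuclideanSpace ℝ (Fin d)

/-! ### Polyhedra with their cell structure -/

/-- The dimension of the affine span of a set. -/
noncomputable def cellDim {d : ℕ} (c : Set (E d)) : ℕ :=
  Module.finrank ℝ (vectorSpan ℝ c)

/-- A flat closed cell: a closed topological ball of dimension `k` lying in an affine subspace of the
same dimension `k`, the bounding sphere corresponding to the boundary relative to that subspace. -/
def IsFlatCell {d : ℕ} (c : Set (E d)) : Prop :=
  ∃ h : Metric.closedBall (0 : E (cellDim c)) 1 ≃ₜ c,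
    ∀ p : Metric.closedBall (0 : E (cellDim c)) 1, (p : E (cellDim c)) ∈ Metric.sphere (0 : E (cellDim c)) 1 ↔
      (h p : E d) ∈ intrinsicFrontier ℝ c

/-- A `d`-dimensional polyhedron in `ℝ^d` (a topological ball, not necessarily convex), given with its
finite decomposition into flat cells: vertices, edges, 2-cells, ..., and the polyhedron itself. -/
structure Polyhedron (d : ℕ) where
  body : Set (E d)
  cells : Set (Set (E d))
  finite_cells : cells.Finite
  body_mem : body ∈ cells
  cellDim_body : cellDim body = d
  subset_body : ∀ c ∈ cells, c ⊆ body
  isFlatCell : ∀ c ∈ cells, IsFlatCell c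
  frontier_eq : ∀ c ∈ cells, intrinsicFrontier ℝ c = ⋃ c' ∈ {c' ∈ cells | c' ⊂ c}, c'
  disjoint_interiors : ∀ c ∈ cells, ∀ c' ∈ cells, c ≠ c' →
    Disjoint (intrinsicInterior ℝ c) (intrinsicInterior ℝ c')

/-- `(v, w)` is an oriented edge of the polyhedron. -/
def Polyhedron.IsEdge {d : ℕ} (A : Polyhedron d) (v w : E d) : Prop :=
  v ≠ w ∧ {v} ∈ A.cells ∧ {w} ∈ A.cells ∧ segment ℝ v w ∈ A.cells

theorem Polyhedron.IsEdge.symm {d : ℕ} {A : Polyhedron d} {v w : E d} (h : A.IsEdge v w) :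
    A.IsEdge w v :=
  ⟨h.1.symm, h.2.2.1, h.2.1, segment_symm ℝ v w ▸ h.2.2.2⟩

theorem Polyhedron.body_nonempty {d : ℕ} (A : Polyhedron d) : A.body.Nonempty := by
  obtain ⟨h, -⟩ := A.isFlatCell _ A.body_mem
  exact ⟨_, (h ⟨0, by simp⟩).2⟩

/-! ### Tilings -/

section Tilings

variable {d : ℕ} {𝒜 : Type*}

/-- A tile `(a, v)` is the translate by `v` of the prototile of type `a`; this is the region that it
occupies. -/
def region (P : 𝒜 → Polyhedron d) (t : 𝒜 × E d) : Set (E d) := t.2 +ᵥ (P t.1).body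

/-- A tiling of `ℝ^d` by translates of the (labelled) prototiles `P a`, meeting full-face to full-face:
the tiles cover, distinct tiles have disjoint interiors, and cells of tiles whose relative interiors
meet coincide. -/
@[ext]
structure Tiling (P : 𝒜 → Polyhedron d) where
  tiles : Set (𝒜 × E d)
  cover : ∀ p : E d, ∃ t ∈ tiles, p ∈ region P t
  disjoint : ∀ t ∈ tiles, ∀ s ∈ tiles, t ≠ s →
    Disjoint (t.2 +ᵥ interior (P t.1).body) (s.2 +ᵥ interior (P s.1).body)
  face_to_face : ∀ t ∈ tiles, ∀ s ∈ tiles, ∀ c ∈ (P t.1).cells, ∀ c' ∈ (P s.1).cells,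
    ((t.2 +ᵥ intrinsicInterior ℝ c) ∩ (s.2 +ᵥ intrinsicInterior ℝ c')).Nonempty →
      t.2 +ᵥ c = s.2 +ᵥ c'

variable {P : 𝒜 → Polyhedron d}

theorem vadd_neg_vadd_set (z v : E d) (c : Set (E d)) : z +ᵥ ((-z + v) +ᵥ c) = v +ᵥ c := by
  rw [vadd_vadd, add_neg_cancel_left]

/-- The translate `z +ᵥ X` of a tiling. -/
instance : VAdd (E d) (Tiling P) where
  vadd z X :=
    { tiles := {t | (t.1, -z + t.2) ∈ X.tiles}
      cover := by
        intro p
        obtain ⟨t, ht, hp⟩ := X.cover (-z + p)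
        refine ⟨(t.1, z + t.2), by simpa using ht, ?_⟩
        obtain ⟨q, hq, h⟩ := Set.mem_vadd_set.1 hp
        refine Set.mem_vadd_set.2 ⟨q, hq, ?_⟩
        simp only [vadd_eq_add] at h ⊢
        rw [add_assoc, h, add_neg_cancel_left]
      disjoint := by
        intro t ht s hs hne
        have h := X.disjoint _ ht _ hs (by
          intro h
          simp only [Prod.mk.injEq, add_right_inj] at h
          exact hne (Prod.ext h.1 h.2))
        have h' := (Set.disjoint_vadd_set (a := z)).2 h
        simpa only [vadd_neg_vadd_set] using h'
      face_to_face := by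
        intro t ht s hs c hc c' hc' hne
        have h := X.face_to_face _ ht _ hs c hc c' hc' (by
          rw [← Set.vadd_set_nonempty (a := z), Set.vadd_set_inter]
          simpa only [vadd_neg_vadd_set] using hne)
        have h' := congrArg (fun u => z +ᵥ u) h
        simpa only [vadd_neg_vadd_set] using h' }

theorem Tiling.mem_vadd {z : E d} {X : Tiling P} {t : 𝒜 × E d} :
    t ∈ (z +ᵥ X).tiles ↔ (t.1, -z + t.2) ∈ X.tiles := Iff.rfl

/-- `ℝ^d` acts on tilings by translation. -/
instance : AddAction (E d) (Tiling P) where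
  zero_vadd X := by
    ext t
    simp [Tiling.mem_vadd]
  add_vadd z z' X := by
    ext t
    simp [Tiling.mem_vadd, add_assoc]

/-- Two tilings agree on the closed ball of radius `r` around the origin. -/
def AgreeOnBall (X Y : Tiling P) (r : ℝ) : Prop :=
  ∀ t, (region P t ∩ Metric.closedBall 0 r).Nonempty → (t ∈ X.tiles ↔ t ∈ Y.tiles)

/-- Two tilings agree on the ball of radius `1/ε` around the origin up to a translation of size
less than `ε`. -/
def Close (ε : ℝ) (X Y : Tiling P) : Prop :=
  ∃ u : E d, ‖u‖ < ε ∧ AgreeOnBall (u +ᵥ X) Y (1 / ε)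

theorem Close.mono {ε ε' : ℝ} (hε : 0 < ε) (h : ε ≤ ε') {X Y : Tiling P} (hc : Close ε X Y) :
    Close ε' X Y := by
  obtain ⟨u, hu, ha⟩ := hc
  refine ⟨u, hu.trans_le h, fun t ht => ha t (ht.mono ?_)⟩
  exact Set.inter_subset_inter_right _
    (Metric.closedBall_subset_closedBall (one_div_le_one_div_of_le hε h))

/-- The tiling topology: two tilings are near each other if they agree on a large ball around the
origin up to a small translation. -/
instance : TopologicalSpace (Tiling P) where
  IsOpen U := ∀ X ∈ U, ∃ ε > 0, ∀ Y, Close ε X Y → Y ∈ U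
  isOpen_univ := fun _ _ => ⟨1, one_pos, fun _ _ => trivial⟩
  isOpen_inter := by
    intro U V hU hV X hX
    obtain ⟨ε, hε, h⟩ := hU X hX.1
    obtain ⟨δ, hδ, h'⟩ := hV X hX.2
    have hm : 0 < min ε δ := lt_min hε hδ
    exact ⟨min ε δ, hm, fun Y hY =>
      ⟨h Y (hY.mono hm (min_le_left _ _)), h' Y (hY.mono hm (min_le_right _ _))⟩⟩
  isOpen_sUnion := by
    intro S hS X ⟨U, hU, hX⟩
    obtain ⟨ε, hε, h⟩ := hS U hU X hX
    exact ⟨ε, hε, fun Y hY => ⟨U, hU, h Y hY⟩⟩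

/-- A minimal tiling space with prototiles `P`: a nonempty, closed, translation invariant set of
tilings in which every translation orbit is dense. -/
structure TilingSpace (P : 𝒜 → Polyhedron d) where
  carrier : Set (Tiling P)
  nonempty : carrier.Nonempty
  closed : IsClosed carrier
  vadd_mem : ∀ X ∈ carrier, ∀ z : E d, z +ᵥ X ∈ carrier
  minimal : ∀ X ∈ carrier, carrier ⊆ closure (AddAction.orbit (E d) X)

/-! ### The approximants `Γ^(k)` -/

/-- The `k`-times collared tiles `t` of `X` and `t'` of `X'` are translates of each other: a `0`-times
collared tile is a tile, and a `(k+1)`-times collared tile is a tile labelled by the patch of all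
`k`-times collared tiles that touch it. -/
def SameCollar (X X' : Tiling P) : ℕ → 𝒜 × E d → 𝒜 × E d → Prop
  | 0, t, t' => t.1 = t'.1
  | k + 1, t, t' => t.1 = t'.1 ∧
      (∀ s ∈ X.tiles, (region P t ∩ region P s).Nonempty →
        (s.1, s.2 + (t'.2 - t.2)) ∈ X'.tiles ∧
          SameCollar X X' k s (s.1, s.2 + (t'.2 - t.2))) ∧
      (∀ s' ∈ X'.tiles, (region P t' ∩ region P s').Nonempty →
        (s'.1, s'.2 + (t.2 - t'.2)) ∈ X.tiles ∧
          SameCollar X X' k (s'.1, s'.2 + (t.2 - t'.2)) s')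

theorem SameCollar.of_succ {X X' : Tiling P} {k : ℕ} {t t' : 𝒜 × E d} (ht : t ∈ X.tiles)
    (h : SameCollar X X' (k + 1) t t') : SameCollar X X' k t t' := by
  obtain ⟨h1, h2, -⟩ := h
  have hne : (region P t ∩ region P t).Nonempty := by
    rw [Set.inter_self]
    exact (P t.1).body_nonempty.vadd_set
  have h3 := (h2 t ht hne).2
  rwa [add_sub_cancel, show (t.1, t'.2) = t' from Prod.ext h1 rfl] at h3

theorem SameCollar.of_le {X X' : Tiling P} {i j : ℕ} (hij : i ≤ j) {t t' : 𝒜 × E d}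
    (ht : t ∈ X.tiles) (h : SameCollar X X' j t t') : SameCollar X X' i t t' := by
  induction j, hij using Nat.le_induction with
  | base => exact h
  | succ n _ ih => exact ih (h.of_succ ht)

/-- A vertex (given as a vertex `v` of a prototile) of a tile `t` of a tiling `X` in the space. -/
structure VertexIn (T : TilingSpace P) where
  X : Tiling P
  mem : X ∈ T.carrier
  t : 𝒜 × E d
  tile_mem : t ∈ X.tiles
  v : E d
  vertex : {v} ∈ (P t.1).cells

/-- The position of the vertex in the tiling. -/
def VertexIn.pos {T : TilingSpace P} (p : VertexIn T) : E d := p.t.2 + p.v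

/-- An oriented edge (given as an edge `(v, w)` of a prototile) of a tile `t` of a tiling `X` in the
space. -/
structure EdgeIn (T : TilingSpace P) where
  X : Tiling P
  mem : X ∈ T.carrier
  t : 𝒜 × E d
  tile_mem : t ∈ X.tiles
  v : E d
  w : E d
  edge : (P t.1).IsEdge v w

namespace EdgeIn

variable {T : TilingSpace P}

/-- The initial vertex. -/
def src (e : EdgeIn T) : VertexIn T := ⟨e.X, e.mem, e.t, e.tile_mem, e.v, e.edge.2.1⟩

/-- The terminal vertex. -/
def tgt (e : EdgeIn T) : VertexIn T := ⟨e.X, e.mem, e.t, e.tile_mem, e.w, e.edge.2.2.1⟩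

/-- The same edge with the opposite orientation. -/
def rev (e : EdgeIn T) : EdgeIn T := ⟨e.X, e.mem, e.t, e.tile_mem, e.w, e.v, e.edge.symm⟩

end EdgeIn

/-- Vertices are identified in `Γ^(k)` if they are corresponding vertices of `k`-times collared tiles
of the same type, or coincide somewhere in a tiling. -/
def VertexRel (T : TilingSpace P) (k : ℕ) (p q : VertexIn T) : Prop :=
  (SameCollar p.X q.X k p.t q.t ∧ p.v = q.v) ∨ (p.X = q.X ∧ p.pos = q.pos)

/-- Oriented edges are identified in `Γ^(k)` if they are corresponding edges of `k`-times collared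
tiles of the same type, or coincide somewhere in a tiling. -/
def EdgeRel (T : TilingSpace P) (k : ℕ) (e e' : EdgeIn T) : Prop :=
  (SameCollar e.X e'.X k e.t e'.t ∧ e.v = e'.v ∧ e.w = e'.w) ∨
    (e.X = e'.X ∧ e.src.pos = e'.src.pos ∧ e.tgt.pos = e'.tgt.pos)

/-- The vertices of `Γ^(k)` (the quotient by the generated equivalence relation). -/
def Vertex (T : TilingSpace P) (k : ℕ) := Quot (VertexRel T k)

/-- The oriented edges of `Γ^(k)` (the quotient by the generated equivalence relation). -/
def Edge (T : TilingSpace P) (k : ℕ) := Quot (EdgeRel T k)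

section Complex

variable (T : TilingSpace P) (k : ℕ)

/-- The edge of `Γ^(k)` represented by an edge of a tiling. -/
def Edge.mk (e : EdgeIn T) : Edge T k := Quot.mk _ e

variable {T k}

def Edge.src : Edge T k → Vertex T k :=
  Quot.map EdgeIn.src (by
    rintro e e' (⟨h, hv, _⟩ | ⟨h, hv, _⟩)
    · exact Or.inl ⟨h, hv⟩
    · exact Or.inr ⟨h, hv⟩)

def Edge.tgt : Edge T k → Vertex T k :=
  Quot.map EdgeIn.tgt (by
    rintro e e' (⟨h, _, hw⟩ | ⟨h, _, hw⟩)
    · exact Or.inl ⟨h, hw⟩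
    · exact Or.inr ⟨h, hw⟩)

def Edge.rev : Edge T k → Edge T k :=
  Quot.map EdgeIn.rev (by
    rintro e e' (⟨h, hv, hw⟩ | ⟨h, hv, hw⟩)
    · exact Or.inl ⟨h, hw, hv⟩
    · exact Or.inr ⟨h, hw, hv⟩)

/-- The forgetful map `Γ^(j) → Γ^(i)` on vertices, for `i ≤ j`. -/
def Vertex.forget {i j : ℕ} (hij : i ≤ j) : Vertex T j → Vertex T i :=
  Quot.map id (by
    rintro p q (⟨h, hv⟩ | h)
    · exact Or.inl ⟨h.of_le hij p.tile_mem, hv⟩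
    · exact Or.inr h)

/-- The forgetful map `Γ^(j) → Γ^(i)` on oriented edges, for `i ≤ j`. -/
def Edge.forget {i j : ℕ} (hij : i ≤ j) : Edge T j → Edge T i :=
  Quot.map id (by
    rintro e e' (⟨h, hv⟩ | h)
    · exact Or.inl ⟨h.of_le hij e.tile_mem, hv⟩
    · exact Or.inr h)

end Complex

/-! ### Edge paths -/

/-- Paths along edges of the tiling `X`, from a point to a point. -/
inductive EdgePath (T : TilingSpace P) (X : Tiling P) : E d → E d → Type _
  | nil (p : E d) : EdgePath T X p p
  | cons {p q r : E d} (γ : EdgePath T X p q) (e : EdgeIn T) (hX : e.X = X)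
      (hq : e.src.pos = q) (hr : e.tgt.pos = r) : EdgePath T X p r

namespace EdgePath

variable {T : TilingSpace P} {X : Tiling P}

/-- The value of a function on the oriented edges of `Γ^(k)` on the image in `Γ^(k)` of a path. -/
def eval {k : ℕ} (c : Edge T k → E d) : {p q : E d} → EdgePath T X p q → E d
  | _, _, nil _ => 0
  | _, _, cons γ e _ _ _ => eval c γ + c (Edge.mk T k e)

/-- All edges of the path lie in the set `F`. -/
def LiesIn (F : Set (E d)) : {p q : E d} → EdgePath T X p q → Prop
  | _, _, nil _ => True
  | _, _, cons γ e _ _ _ => LiesIn F γ ∧ segment ℝ e.src.pos e.tgt.pos ⊆ F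

theorem eval_zero {k : ℕ} {p q : E d} (γ : EdgePath T X p q) :
    γ.eval (0 : Edge T k → E d) = 0 := by
  induction γ with
  | nil => simp [eval]
  | cons γ e _ _ _ ih => simp [eval, ih]

theorem eval_add {k : ℕ} (c c' : Edge T k → E d) {p q : E d} (γ : EdgePath T X p q) :
    γ.eval (c + c') = γ.eval c + γ.eval c' := by
  induction γ with
  | nil => simp [eval]
  | cons γ e _ _ _ ih => simp only [eval, ih, Pi.add_apply]; abel

theorem eval_smul {k : ℕ} (a : ℝ) (c : Edge T k → E d) {p q : E d} (γ : EdgePath T X p q) :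
    γ.eval (a • c) = a • γ.eval c := by
  induction γ with
  | nil => simp [eval]
  | cons γ e _ _ _ ih => simp only [eval, ih, Pi.smul_apply, smul_add]

theorem eval_forget {i j : ℕ} (hij : i ≤ j) (c : Edge T i → E d) {p q : E d}
    (γ : EdgePath T X p q) : γ.eval (c ∘ Edge.forget hij) = γ.eval c := by
  induction γ with
  | nil => simp [eval]
  | cons γ e _ _ _ ih => simp only [eval, ih]; rfl

end EdgePath

/-! ### Cellular cohomology of `Γ^(k)` with values in `ℝ^d` -/

section Cohomology

variable (T : TilingSpace P) (k : ℕ)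

/-- The `1`-cochains of `Γ^(k)`: functions of oriented edges that change sign with the
orientation. -/
def C1 : Submodule ℝ (Edge T k → E d) where
  carrier := {c | ∀ e, c e.rev = -c e}
  zero_mem' := by intro e; simp
  add_mem' := by intro a b ha hb e; simp [ha e, hb e, add_comm]
  smul_mem' := by intro r a ha e; simp [ha e]

/-- The `1`-cocycles of `Γ^(k)`: the sum around the boundary of every 2-cell is zero. -/
def Z1 : Submodule ℝ (Edge T k → E d) where
  carrier := {c | c ∈ C1 T k ∧ ∀ X ∈ T.carrier, ∀ t ∈ X.tiles, ∀ F ∈ (P t.1).cells,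
    cellDim F = 2 → ∀ (p : E d) (γ : EdgePath T X p p), γ.LiesIn (t.2 +ᵥ F) → γ.eval c = 0}
  zero_mem' := ⟨zero_mem _, by intros; exact EdgePath.eval_zero _⟩
  add_mem' := by
    rintro a b ⟨ha, ha'⟩ ⟨hb, hb'⟩
    refine ⟨add_mem ha hb, fun X hX t ht F hF h2 p γ hγ => ?_⟩
    rw [EdgePath.eval_add, ha' X hX t ht F hF h2 p γ hγ, hb' X hX t ht F hF h2 p γ hγ, add_zero]
  smul_mem' := by
    rintro r a ⟨ha, ha'⟩
    refine ⟨Submodule.smul_mem _ _ ha, fun X hX t ht F hF h2 p γ hγ => ?_⟩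
    rw [EdgePath.eval_smul, ha' X hX t ht F hF h2 p γ hγ, smul_zero]

/-- The coboundary of a `0`-cochain. -/
def delta0 : (Vertex T k → E d) →ₗ[ℝ] (Edge T k → E d) where
  toFun β := fun e => β e.tgt - β e.src
  map_add' β β' := by ext1 e; simp only [Pi.add_apply]; abel
  map_smul' r β := by ext1 e; simp [smul_sub]

/-- The `1`-coboundaries of `Γ^(k)`, as a submodule of the `1`-cocycles. -/
def B1 : Submodule ℝ (Z1 T k) := (LinearMap.range (delta0 T k)).submoduleOf (Z1 T k)

/-- The cohomology group `H^1(Γ^(k), ℝ^d)`. -/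
abbrev H1 : Type _ := Z1 T k ⧸ B1 T k

/-- Pullback of cocycles under the forgetful map `Γ^(j) → Γ^(i)`. -/
def pullbackZ1 {i j : ℕ} (hij : i ≤ j) : Z1 T i →ₗ[ℝ] Z1 T j where
  toFun c := ⟨c.1 ∘ Edge.forget hij, by
    constructor
    · intro e
      induction e using Quot.ind with
      | mk e => exact c.2.1 (Edge.mk T i e)
    · intro X hX t ht F hF h2 p γ hγ
      rw [EdgePath.eval_forget]
      exact c.2.2 X hX t ht F hF h2 p γ hγ⟩
  map_add' _ _ := rfl
  map_smul' _ _ := rfl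

theorem B1_le_comap {i j : ℕ} (hij : i ≤ j) : B1 T i ≤ (B1 T j).comap (pullbackZ1 T hij) := by
  rintro c ⟨β, hβ⟩
  refine ⟨β ∘ Vertex.forget hij, ?_⟩
  ext1 e
  induction e using Quot.ind with
  | mk e => exact congrFun hβ (Edge.mk T i e)

/-- Pullback of cohomology classes under the forgetful map `Γ^(j) → Γ^(i)`. -/
def pullbackH1 (i j : ℕ) (hij : i ≤ j) : H1 T i →ₗ[ℝ] H1 T j :=
  Submodule.mapQ _ _ (pullbackZ1 T hij) (B1_le_comap T hij)

/-- The Cech cohomology `H^1(𝒯, ℝ^d)` of the tiling space, which is the inverse limit of the `Γ^(k)`: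
the direct limit of the `H^1(Γ^(k), ℝ^d)` under the forgetful maps. -/
abbrev HT : Type _ := Module.DirectLimit (H1 T) (pullbackH1 T)

noncomputable instance : AddCommGroup (HT T) :=
  Module.DirectLimit.addCommGroup (H1 T) (pullbackH1 T)

/-- Pullback `H^1(Γ^(k), ℝ^d) → H^1(𝒯, ℝ^d)` under the projection of `𝒯` to `Γ^(k)`. -/
noncomputable def pullback : H1 T k →ₗ[ℝ] HT T := Module.DirectLimit.of ℝ ℕ (H1 T) (pullbackH1 T) k

/-- The class `𝓘(f)` in `H^1(𝒯, ℝ^d)` of a shape function. -/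
noncomputable def shapeClass (f : Z1 T 0) : HT T := pullback T 0 (Submodule.Quotient.mk f)

end Cohomology

/-! ### Recurrences and asymptotic negligibility -/

/-- The size of the recurrence `(z₁, z₂)` in `X`: the supremum of the radii of the balls around `z₁`
and `z₂` on which `X` agrees up to translation by `z₂ - z₁`. -/
noncomputable def recurrenceSize (X : Tiling P) (z₁ z₂ : E d) : ℝ≥0∞ :=
  ⨆ (r : ℝ≥0) (_ : AgreeOnBall (-z₁ +ᵥ X) (-z₂ +ᵥ X) r), (r : ℝ≥0∞)

/-- `z` is a vertex of the tiling `X`. -/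
def Tiling.IsVertex (X : Tiling P) (z : E d) : Prop :=
  ∃ t ∈ X.tiles, ∃ v, {v} ∈ (P t.1).cells ∧ t.2 + v = z

/-- A class in `H^1(Γ^(k), ℝ^d)` is asymptotically negligible if its values on recurrences of large size
(evaluated along edge paths joining the two points) are arbitrarily small. -/
def IsNegligible (T : TilingSpace P) (k : ℕ) (η : H1 T k) : Prop :=
  ∃ c : Z1 T k, Submodule.Quotient.mk c = η ∧
    ∀ ε : ℝ, 0 < ε → ∃ R : ℝ≥0, ∀ X ∈ T.carrier, ∀ z₁ z₂ : E d, X.IsVertex z₁ → X.IsVertex z₂ →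
      (R : ℝ≥0∞) < recurrenceSize X z₁ z₂ → ∀ γ : EdgePath T X z₁ z₂, ‖γ.eval c.1‖ < ε

/-- A class in `H^1(𝒯, ℝ^d)` is asymptotically negligible if it is the pullback of an asymptotically
negligible class in some `H^1(Γ^(k), ℝ^d)`. -/
def IsAsymptoticallyNegligible (T : TilingSpace P) (ξ : HT T) : Prop :=
  ∃ (k : ℕ) (η : H1 T k), IsNegligible T k η ∧ pullback T k η = ξ

/-! ### Deformed tiling spaces -/

/-- Tilings `X` (by prototiles `P`) and `Y` (by prototiles `Q`, whose cells correspond to those of `P`)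
have the same combinatorics: their tiles correspond, with the same types, and cells of tiles
coincide in `X` exactly where the corresponding cells coincide in `Y`. -/
def SameCombinatorics {P Q : 𝒜 → Polyhedron d} (Φ : ∀ a, (P a).cells ≃o (Q a).cells)
    (X : Tiling P) (Y : Tiling Q) : Prop :=
  ∃ σ : X.tiles ≃ Y.tiles, (∀ t, (σ t).1.1 = t.1.1) ∧
    ∀ (t s : X.tiles) (c : (P t.1.1).cells) (c' : (P s.1.1).cells),
      t.1.2 +ᵥ (c : Set (E d)) = s.1.2 +ᵥ (c' : Set (E d)) ↔
        (σ t).1.2 +ᵥ (Φ _ c : Set (E d)) = (σ s).1.2 +ᵥ (Φ _ c' : Set (E d))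

/-- A realization of the shape function `f`, which makes it admissible: polyhedra with the same cell
structure as the prototiles and with edge vectors given by `f`, which fit together to tilings of
`ℝ^d` with the combinatorics of the tilings of the given space. -/
structure Realization (T : TilingSpace P) (f : Z1 T 0) where
  proto : 𝒜 → Polyhedron d
  cellIso : ∀ a, (P a).cells ≃o (proto a).cells
  cellDim_eq : ∀ a (c : (P a).cells), cellDim (cellIso a c : Set (E d)) = cellDim (c : Set (E d))
  edge_eq : ∀ (e : EdgeIn T) (v' w' : E d),
    (cellIso e.t.1 ⟨{e.v}, e.edge.2.1⟩ : Set (E d)) = {v'} →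
    (cellIso e.t.1 ⟨{e.w}, e.edge.2.2.1⟩ : Set (E d)) = {w'} →
      w' - v' = f.1 (Edge.mk T 0 e)
  realizes : ∀ X ∈ T.carrier, ∃ Y : Tiling proto, SameCombinatorics cellIso X Y

/-- The deformed tiling space `𝒯_f`: all tilings by the deformed prototiles that have the same
combinatorics as some tiling in the original space. -/
def Realization.space {T : TilingSpace P} {f : Z1 T 0} (D : Realization T f) :
    Set (Tiling D.proto) :=
  {Y | ∃ X ∈ T.carrier, SameCombinatorics D.cellIso X Y}

theorem SameCombinatorics.vadd {P Q : 𝒜 → Polyhedron d} {Φ : ∀ a, (P a).cells ≃o (Q a).cells}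
    {X : Tiling P} {Y : Tiling Q} (h : SameCombinatorics Φ X Y) (z : E d) :
    SameCombinatorics Φ X (z +ᵥ Y) := by
  obtain ⟨σ, h1, h2⟩ := h
  let τ : Y.tiles ≃ (z +ᵥ Y).tiles :=
    { toFun := fun t => ⟨(t.1.1, z + t.1.2), by
        rw [Tiling.mem_vadd, neg_add_cancel_left]
        exact t.2⟩
      invFun := fun t => ⟨(t.1.1, -z + t.1.2), t.2⟩
      left_inv := fun t => by ext1; simp
      right_inv := fun t => by ext1; simp }
  refine ⟨σ.trans τ, fun t => h1 t, fun t s c c' => ?_⟩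
  rw [h2]
  change _ ↔ (z + (σ t).1.2) +ᵥ _ = (z + (σ s).1.2) +ᵥ _
  rw [add_vadd, add_vadd, (AddAction.injective z).eq_iff]

/-- `ℝ^d` acts on `𝒯_f` by translation. -/
instance {T : TilingSpace P} {f : Z1 T 0} (D : Realization T f) : VAdd (E d) D.space where
  vadd z Y := ⟨z +ᵥ Y.1, by
    obtain ⟨X, hX, h⟩ := Y.2
    exact ⟨X, hX, h.vadd z⟩⟩

end Tilings

end TilingDeformation

open scoped Pointwise NNReal ENNReal

/-! Fix `X` in the tiling space. In a deformation of `X` the sums of the shape function along edge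
paths give the displacements between vertices, so the deformed tiling is determined up to one
translation. A conjugacy therefore amounts to a coherent choice of the relative translation between
the `f`- and the `g`-deformation of each `X`. The difference of the two positions of a vertex is a
function `b X x` of vertices whose increment along an edge is `f - g`. If `b` can be chosen
translation invariant and continuous in `X` (`IsTransfer`), then moving each vertex of the
`f`-deformation by `-b` gives the required map.

Such a `b` exists because of negligibility. In some `Γ^(j)` the difference `f - g` is the sum of a
cocycle `c` that is small on large recurrences and a coboundary `δβ` (`exists_eq_add_coboundary`).
On a fixed `X₀` let `b₀` be the difference of vertex positions in two chosen deformations. At the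
two ends of a large recurrence in `X₀` the values of `β` are equal, so `b₀` changes only by a value
of `c`, which is small. Translates of `X₀` approximate every tiling, by minimality, and the values
of `b₀` along them are Cauchy; `b` is the limit (`exists_isTransfer`).

The conjugacy is built from the relation `Matched`: two deformations of a common `X` whose vertices
differ by `b`. A partner exists because the 1-skeleton is connected (`exists_matched`).
`Matched.exists_close` gives continuity: large patches of a deformation and of `X` determine each
other, and `b` is continuous. It also gives uniqueness of the partner. The inverse comes from `-b`.
-/

namespace TilingDeformation

/-! ### Geometry of flat cells -/

section FlatCells

variable {d : ℕ} {c : Set (E d)}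

theorem IsFlatCell.isCompact (hc : IsFlatCell c) : IsCompact c := by
  obtain ⟨h, -⟩ := hc
  have : CompactSpace (Metric.closedBall (0 : E (cellDim c)) 1) :=
    isCompact_iff_compactSpace.1 (isCompact_closedBall _ _)
  exact isCompact_iff_compactSpace.2 h.compactSpace

theorem IsFlatCell.isClosed (hc : IsFlatCell c) : IsClosed c := hc.isCompact.isClosed

theorem IsFlatCell.nonempty (hc : IsFlatCell c) : c.Nonempty := by
  obtain ⟨h, -⟩ := hc
  exact ⟨_, (h ⟨0, by simp⟩).2⟩

theorem IsFlatCell.isPreconnected (hc : IsFlatCell c) : IsPreconnected c := by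
  obtain ⟨h, -⟩ := hc
  have : PreconnectedSpace (Metric.closedBall (0 : E (cellDim c)) 1) :=
    isPreconnected_iff_preconnectedSpace.1 (convex_closedBall _ _).isPreconnected
  have h2 := isPreconnected_range (f := fun p => (h p : E d)) (by fun_prop)
  convert h2
  ext x
  constructor
  · intro hx
    exact ⟨h.symm ⟨x, hx⟩, by simp⟩
  · rintro ⟨p, rfl⟩
    exact (h p).2

theorem IsFlatCell.interior_union_frontier (hc : IsFlatCell c) :
    intrinsicInterior ℝ c ∪ intrinsicFrontier ℝ c = c := by
  rw [intrinsicInterior_union_intrinsicFrontier, intrinsicClosure_eq_closure,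
    hc.isClosed.closure_eq]

theorem IsFlatCell.frontier_subset (hc : IsFlatCell c) : intrinsicFrontier ℝ c ⊆ c :=
  intrinsicFrontier_subset hc.isClosed

theorem IsFlatCell.mem_interior_of_notMem_frontier (hc : IsFlatCell c) {x : E d} (hx : x ∈ c)
    (hx' : x ∉ intrinsicFrontier ℝ c) : x ∈ intrinsicInterior ℝ c := by
  rw [← hc.interior_union_frontier] at hx
  exact hx.resolve_right hx'

theorem notMem_frontier_of_mem_interior {x : E d} (hx : x ∈ intrinsicInterior ℝ c) :
    x ∉ intrinsicFrontier ℝ c := by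
  intro h
  rw [← intrinsicClosure_sdiff_intrinsicFrontier] at hx
  exact hx.2 h

theorem IsFlatCell.subset_closure_interior (hc : IsFlatCell c) :
    c ⊆ closure (intrinsicInterior ℝ c) := by
  intro x hx
  have hc' := hc
  obtain ⟨h, hh⟩ := hc
  set q := h.symm ⟨x, hx⟩ with hq
  have hq' : (q : E (cellDim c)) ∈ closure (Metric.ball (0 : E (cellDim c)) 1) := by
    rw [closure_ball _ one_ne_zero]
    exact q.2
  have hxq : (h q : E d) = x := by simp [hq]
  have hcl : q ∈ closure {p : Metric.closedBall (0 : E (cellDim c)) 1 |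
      (p : E (cellDim c)) ∈ Metric.ball (0 : E (cellDim c)) 1} := by
    rw [closure_subtype]
    refine closure_mono ?_ hq'
    intro y hy
    exact ⟨⟨y, Metric.ball_subset_closedBall hy⟩, hy, rfl⟩
  have hcont : Continuous fun p => (h p : E d) := by fun_prop
  rw [← hxq]
  refine closure_mono ?_ (image_closure_subset_closure_image hcont ⟨q, hcl, rfl⟩)
  rintro _ ⟨p, hp, rfl⟩
  refine hc'.mem_interior_of_notMem_frontier (h p).2 fun hf => ?_
  have := (hh p).2 hf
  simp only [Set.mem_ofPred_eq, mem_ball_zero_iff, mem_sphere_iff_norm, sub_zero] at hp this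
  exact hp.ne this

theorem IsFlatCell.frontier_eq_image (hc : IsFlatCell c) :
    ∃ h : Metric.closedBall (0 : E (cellDim c)) 1 ≃ₜ c,
      intrinsicFrontier ℝ c = (fun p => (h p : E d)) '' {p | ‖(p : E (cellDim c))‖ = 1} := by
  have hc' := hc
  obtain ⟨h, hh⟩ := hc
  refine ⟨h, ?_⟩
  ext x
  constructor
  · intro hx
    refine ⟨h.symm ⟨x, hc'.frontier_subset hx⟩, ?_, by simp⟩
    have := (hh (h.symm ⟨x, hc'.frontier_subset hx⟩)).2 (by simpa using hx)
    simpa using this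
  · rintro ⟨p, hp, rfl⟩
    exact (hh p).1 (by simpa using hp)

theorem IsFlatCell.isPreconnected_frontier (hc : IsFlatCell c) (h2 : 2 ≤ cellDim c) :
    IsPreconnected (intrinsicFrontier ℝ c) := by
  obtain ⟨h, hh⟩ := hc.frontier_eq_image
  rw [hh]
  refine IsPreconnected.image ?_ _ (by fun_prop)
  have h1 : IsPreconnected (Metric.sphere (0 : E (cellDim c)) 1) := by
    refine isPreconnected_sphere ?_ _ _
    rw [← Module.finrank_eq_rank, finrank_euclideanSpace_fin]
    exact_mod_cast h2
  rw [← Topology.IsInducing.subtypeVal.isPreconnected_image]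
  convert h1
  ext x
  simp only [Set.mem_image, Set.mem_ofPred_eq, Subtype.exists, mem_sphere_iff_norm, sub_zero]
  constructor
  · rintro ⟨y, hy, h1, rfl⟩
    exact h1
  · intro hx
    exact ⟨x, by simp [hx], hx, rfl⟩

theorem IsFlatCell.cellDim_eq_zero (hc : IsFlatCell c) (hf : intrinsicFrontier ℝ c = ∅) :
    cellDim c = 0 := by
  by_contra hne
  have : Nonempty (Fin (cellDim c)) := ⟨⟨0, Nat.pos_of_ne_zero hne⟩⟩
  obtain ⟨h, hh⟩ := hc.frontier_eq_image
  obtain ⟨p, hp⟩ := (NormedSpace.sphere_nonempty (x := (0 : E (cellDim c))) (r := 1)).2 zero_le_one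
  rw [hh, Set.image_eq_empty] at hf
  have : (⟨p, by simpa using (by simpa using hp : ‖p‖ = 1).le⟩ :
      Metric.closedBall (0 : E (cellDim c)) 1) ∈ (∅ : Set _) := by
    rw [← hf]
    simpa using hp
  exact this

theorem IsFlatCell.eq_singleton (hc : IsFlatCell c) (h0 : cellDim c = 0) : ∃ v, c = {v} := by
  have h1 : vectorSpan ℝ c = ⊥ := Submodule.finrank_eq_zero.1 h0
  have h2 : c.Subsingleton := (vectorSpan_eq_bot_iff_subsingleton ℝ).1 h1
  obtain ⟨v, hv⟩ := hc.nonempty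
  exact ⟨v, h2.eq_singleton_of_mem hv⟩

theorem cellDim_singleton (v : E d) : cellDim ({v} : Set (E d)) = 0 := by
  simp [cellDim]

theorem IsFlatCell.exists_frontier_eq_pair (hc : IsFlatCell c) (h1 : cellDim c = 1) :
    ∃ a b, a ≠ b ∧ intrinsicFrontier ℝ c = {a, b} := by
  obtain ⟨h, hh⟩ := hc.frontier_eq_image
  -- The type of `h` mentions `cellDim c`, so it is generalized before the dimension is rewritten.
  revert h
  rw [h1]
  intro h hh
  let u : E 1 := EuclideanSpace.single 0 1
  have hu : ‖u‖ = 1 := by simp [u]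
  let p : Metric.closedBall (0 : E 1) 1 := ⟨u, by simp [hu]⟩
  let q : Metric.closedBall (0 : E 1) 1 := ⟨-u, by simp [hu]⟩
  have hpq : p ≠ q := by
    intro hpq
    have h3 : u = -u := congrArg Subtype.val hpq
    have h4 : u = 0 := by
      have h5 : (2 : ℝ) • u = 0 := by rw [two_smul]; nth_rewrite 2 [h3]; exact add_neg_cancel u
      exact (smul_eq_zero.1 h5).resolve_left two_ne_zero
    simp [h4] at hu
  refine ⟨h p, h q, fun hpq' => hpq (h.injective (Subtype.ext hpq')), ?_⟩
  rw [hh]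
  ext x
  simp only [Set.mem_image, Set.mem_ofPred_eq, Set.mem_insert_iff, Set.mem_singleton_iff]
  constructor
  · rintro ⟨r, hr, rfl⟩
    have h5 : |(r : E 1) 0| = 1 := by
      rw [EuclideanSpace.norm_eq] at hr
      simpa [Real.sqrt_sq_eq_abs] using hr
    rcases (abs_eq zero_le_one).1 h5 with h6 | h6
    · left
      have : r = p := by
        ext i
        rw [Subsingleton.elim i 0, h6]
        simp [p, u]
      rw [this]
    · right
      have : r = q := by
        ext i
        rw [Subsingleton.elim i 0, h6]
        simp [q, u]
      rw [this]
  · rintro (rfl | rfl)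
    · exact ⟨p, hu, rfl⟩
    · exact ⟨q, by simpa [q] using hu, rfl⟩

theorem exists_lineMap_of_cellDim_eq_one (h1 : cellDim c = 1) {a b x : E d} (ha : a ∈ c)
    (hb : b ∈ c) (hab : a ≠ b) (hx : x ∈ affineSpan ℝ c) : ∃ s : ℝ, x = a + s • (b - a) := by
  have hba : b - a ∈ vectorSpan ℝ c := vsub_mem_vectorSpan ℝ hb ha
  have hxa : x - a ∈ vectorSpan ℝ c := by
    rw [← direction_affineSpan]
    exact AffineSubspace.vsub_mem_direction hx (subset_affineSpan ℝ c ha)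
  obtain ⟨s, hs⟩ := exists_smul_eq_of_finrank_eq_one h1 (x := ⟨b - a, hba⟩)
    (by simpa [Subtype.ext_iff, sub_eq_zero] using hab.symm) ⟨x - a, hxa⟩
  refine ⟨s, ?_⟩
  have := congrArg Subtype.val hs
  simp only [Submodule.coe_smul] at this
  rw [this]
  abel

theorem IsFlatCell.isPreconnected_lineMap_preimage (hc : IsFlatCell c) (h1 : cellDim c = 1)
    {a b : E d} (hab : a ≠ b) (ha : a ∈ c) (hb : b ∈ c) :
    IsPreconnected {r : ℝ | a + r • (b - a) ∈ c} := by
  let g : E d → ℝ := fun x => inner ℝ (b - a) (x - a) / inner ℝ (b - a) (b - a)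
  have hg : ∀ r : ℝ, g (a + r • (b - a)) = r := by
    intro r
    have : inner ℝ (b - a) (b - a) ≠ 0 := inner_self_ne_zero.2 (sub_ne_zero.2 hab.symm)
    simp only [g, add_sub_cancel_left, inner_smul_right]
    field_simp
  have h2 := hc.isPreconnected.image g (by fun_prop)
  convert h2
  ext r
  constructor
  · intro hr
    exact ⟨_, hr, hg r⟩
  · rintro ⟨x, hx, rfl⟩
    obtain ⟨r, rfl⟩ := exists_lineMap_of_cellDim_eq_one h1 ha hb hab (subset_affineSpan ℝ c hx)
    simpa [hg] using hx

/-- If `s > 1`, connectedness puts all points with parameters in `[0, s]` in the cell. Then `b` has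
a neighbourhood within the line spanned by the cell and is not a frontier point. -/
theorem IsFlatCell.le_one_of_mem (hc : IsFlatCell c) (h1 : cellDim c = 1) {a b : E d}
    (hab : a ≠ b) (ha : a ∈ c) (hb : b ∈ intrinsicFrontier ℝ c) {s : ℝ}
    (hs : a + s • (b - a) ∈ c) : s ≤ 1 := by
  by_contra! hlt
  have hbc := hc.frontier_subset hb
  have hsub : ∀ r ∈ Set.Icc 0 s, a + r • (b - a) ∈ c := by
    have hcl := hc.isPreconnected_lineMap_preimage h1 hab ha hbc
    exact fun r hr => hcl.ordConnected.out (x := 0) (y := s) (by simpa using ha) hs hr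
  refine notMem_frontier_of_mem_interior ?_ hb
  rw [mem_intrinsicInterior]
  refine ⟨⟨b, subset_affineSpan ℝ c hbc⟩, ?_, rfl⟩
  rw [mem_interior]
  have hpos : 0 < inner ℝ (b - a) (b - a) :=
    real_inner_self_pos.2 (sub_ne_zero.2 hab.symm)
  -- On the line this open slab consists of the points with parameter in `(0, s)`.
  refine ⟨{x | inner ℝ (b - a) ((x : E d) - a) ∈
    Set.Ioo 0 (s * inner ℝ (b - a) (b - a))}, ?_, ?_, ?_⟩
  · rintro ⟨x, hx⟩ ⟨hx1, hx2⟩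
    obtain ⟨r, rfl⟩ := exists_lineMap_of_cellDim_eq_one h1 ha hbc hab hx
    simp only [add_sub_cancel_left, inner_smul_right] at hx1 hx2
    exact hsub r ⟨(pos_of_mul_pos_left hx1 hpos.le).le, (lt_of_mul_lt_mul_right hx2 hpos.le).le⟩
  · exact isOpen_Ioo.preimage (by fun_prop)
  · exact ⟨hpos, by nlinarith⟩

theorem IsFlatCell.eq_segment (hc : IsFlatCell c) (h1 : cellDim c = 1) {a b : E d} (hab : a ≠ b)
    (hf : intrinsicFrontier ℝ c = {a, b}) : c = segment ℝ a b := by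
  have haf : a ∈ intrinsicFrontier ℝ c := by simp [hf]
  have hbf : b ∈ intrinsicFrontier ℝ c := by simp [hf]
  have ha := hc.frontier_subset haf
  have hb := hc.frontier_subset hbf
  apply Set.Subset.antisymm
  · intro x hx
    obtain ⟨s, rfl⟩ := exists_lineMap_of_cellDim_eq_one h1 ha hb hab (subset_affineSpan ℝ c hx)
    have h2 := hc.le_one_of_mem h1 hab ha hbf hx
    -- Measured from `b` towards `a`, the same point has parameter `1 - s`; the bound becomes `0 ≤
    -- s`.
    have h3 := hc.le_one_of_mem h1 hab.symm hb haf (s := 1 - s) (by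
      convert hx using 1
      module)
    rw [segment_eq_image']
    exact ⟨s, ⟨by linarith, h2⟩, rfl⟩
  · have hcl := hc.isPreconnected_lineMap_preimage h1 hab ha hb
    rw [segment_eq_image']
    rintro _ ⟨r, hr, rfl⟩
    exact hcl.ordConnected.out (x := 0) (y := 1) (by simpa using ha) (by simpa using hb) hr

/-- Otherwise translation by `x - y` preserves `c` and increases the inner product with `x - y`,
which has a maximum on `c`. This is why the place of a single cell determines the place of its tile.
-/
theorem vadd_set_cancel {c : Set (E d)} (hc : IsCompact c) (hne : c.Nonempty) {x y : E d}
    (h : x +ᵥ c = y +ᵥ c) : x = y := by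
  obtain ⟨p, hp, hmax⟩ := hc.exists_isMaxOn hne (f := fun q => inner ℝ (x - y) q) (by fun_prop)
  have h1 : x + p ∈ y +ᵥ c := by
    rw [← h]
    exact Set.mem_vadd_set.2 ⟨p, hp, rfl⟩
  obtain ⟨q, hq, hqp⟩ := Set.mem_vadd_set.1 h1
  have h2 : q = p + (x - y) := by
    rw [vadd_eq_add] at hqp
    rw [← add_right_inj y, hqp]
    abel
  have h3 := hmax hq
  simp only [Set.mem_ofPred_eq, h2, inner_add_right] at h3
  have h4 : inner ℝ (x - y) (x - y) ≤ 0 := by linarith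
  exact sub_eq_zero.1 (real_inner_self_nonpos.1 h4)

end FlatCells

/-! ### Polyhedra -/

namespace Polyhedron

variable {d : ℕ} (A : Polyhedron d)

theorem induction_ssubset {p : Set (E d) → Prop}
    (h : ∀ c ∈ A.cells, (∀ c' ∈ A.cells, c' ⊂ c → p c') → p c) : ∀ c ∈ A.cells, p c := by
  have : Finite A.cells := A.finite_cells
  have hwf : WellFounded fun c c' : A.cells => (c : Set (E d)) ⊂ c' :=
    wellFounded_lt (α := A.cells)
  intro c hc
  exact hwf.induction (C := fun c : A.cells => p c) ⟨c, hc⟩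
    fun c ih => h c c.2 fun c' hc' hlt => ih ⟨c', hc'⟩ hlt

theorem exists_mem_intrinsicInterior {c : Set (E d)} (hc : c ∈ A.cells) {x : E d} (hx : x ∈ c) :
    ∃ c' ∈ A.cells, c' ⊆ c ∧ x ∈ intrinsicInterior ℝ c' := by
  revert x
  refine A.induction_ssubset
    (p := fun c => ∀ {x}, x ∈ c → ∃ c' ∈ A.cells, c' ⊆ c ∧ x ∈ intrinsicInterior ℝ c') ?_ c hc
  intro c hc ih x hx
  by_cases hf : x ∈ intrinsicFrontier ℝ c
  · rw [A.frontier_eq c hc] at hf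
    simp only [Set.mem_ofPred_eq, Set.mem_iUnion, exists_prop] at hf
    obtain ⟨c', ⟨hc', hlt⟩, hx'⟩ := hf
    obtain ⟨c'', hc'', hle, h⟩ := ih c' hc' hlt hx'
    exact ⟨c'', hc'', hle.trans hlt.1, h⟩
  · exact ⟨c, hc, le_rfl, (A.isFlatCell c hc).mem_interior_of_notMem_frontier hx hf⟩

/-- A cell that is minimal for inclusion has empty relative frontier. A ball of positive dimension
has a nonempty bounding sphere, so that cell is a point. -/
theorem exists_vertex {c : Set (E d)} (hc : c ∈ A.cells) : ∃ v ∈ c, {v} ∈ A.cells := by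
  refine A.induction_ssubset (p := fun c => ∃ v ∈ c, {v} ∈ A.cells) ?_ c hc
  intro c hc ih
  by_cases h : ∃ c' ∈ A.cells, c' ⊂ c
  · obtain ⟨c', hc', hlt⟩ := h
    obtain ⟨v, hv, hv'⟩ := ih c' hc' hlt
    exact ⟨v, hlt.1 hv, hv'⟩
  · push Not at h
    have hf : intrinsicFrontier ℝ c = ∅ := by
      rw [A.frontier_eq c hc, Set.eq_empty_iff_forall_notMem]
      intro x hx
      simp only [Set.mem_ofPred_eq, Set.mem_iUnion, exists_prop] at hx
      obtain ⟨c', ⟨hc', hlt⟩, -⟩ := hx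
      exact h c' hc' hlt
    obtain ⟨v, rfl⟩ := (A.isFlatCell c hc).eq_singleton ((A.isFlatCell c hc).cellDim_eq_zero hf)
    exact ⟨v, rfl, hc⟩

theorem mem_frontier_of_vertex {c : Set (E d)} (hc : c ∈ A.cells) (h0 : cellDim c ≠ 0) {v : E d}
    (hv : {v} ∈ A.cells) (hvc : v ∈ c) : v ∈ intrinsicFrontier ℝ c := by
  rw [A.frontier_eq c hc]
  simp only [Set.mem_ofPred_eq, Set.mem_iUnion, exists_prop]
  refine ⟨{v}, ⟨hv, (Set.singleton_subset_iff.2 hvc).ssubset_of_ne ?_⟩, rfl⟩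
  rintro rfl
  exact h0 (cellDim_singleton v)

/-- Any two vertices of a cell are joined by edges of the polyhedron. -/
theorem reflTransGen_isEdge {c : Set (E d)} (hc : c ∈ A.cells) {v w : E d} (hv : {v} ∈ A.cells)
    (hw : {w} ∈ A.cells) (hvc : v ∈ c) (hwc : w ∈ c) : Relation.ReflTransGen A.IsEdge v w := by
  revert v w
  refine A.induction_ssubset (p := fun c => ∀ {v w}, {v} ∈ A.cells → {w} ∈ A.cells → v ∈ c →
    w ∈ c → Relation.ReflTransGen A.IsEdge v w) ?_ c hc
  intro c hc ih v w hv hw hvc hwc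
  have hcell := A.isFlatCell c hc
  rcases Nat.lt_or_ge (cellDim c) 2 with h2 | h2
  · rcases Nat.lt_succ_iff_lt_or_eq.1 h2 with h1 | h1
    · obtain ⟨u, rfl⟩ := hcell.eq_singleton (Nat.lt_one_iff.1 h1)
      rw [Set.mem_singleton_iff] at hvc hwc
      rw [hvc, hwc]
    · obtain ⟨a, b, hab, hf⟩ := hcell.exists_frontier_eq_pair h1
      have hvert : ∀ x ∈ intrinsicFrontier ℝ c, {x} ∈ A.cells := by
        intro x hx
        have hx' := hx
        rw [A.frontier_eq c hc] at hx'
        simp only [Set.mem_ofPred_eq, Set.mem_iUnion, exists_prop] at hx'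
        obtain ⟨c', ⟨hc', hlt⟩, hxc⟩ := hx'
        have hsub : c' ⊆ {a, b} := by
          rw [← hf, A.frontier_eq c hc]
          exact Set.subset_biUnion_of_mem (u := fun c' => c')
            (show c' ∈ {c' ∈ A.cells | c' ⊂ c} from ⟨hc', hlt⟩)
        -- A proper subcell of an edge is connected and lies in a two-point set.
        have hsing : c'.Subsingleton := by
          have hfin : c'.Finite := (Set.toFinite {a, b}).subset hsub
          exact hfin.countable.isTotallyDisconnected c' le_rfl (A.isFlatCell c' hc').isPreconnected
        rwa [← hsing.eq_singleton_of_mem hxc]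
      have ha : a ∈ intrinsicFrontier ℝ c := by simp [hf]
      have hb : b ∈ intrinsicFrontier ℝ c := by simp [hf]
      have hedge : A.IsEdge a b := ⟨hab, hvert a ha, hvert b hb, by
        rw [← hcell.eq_segment h1 hab hf]
        exact hc⟩
      have hv' := A.mem_frontier_of_vertex hc (by omega) hv hvc
      have hw' := A.mem_frontier_of_vertex hc (by omega) hw hwc
      rw [hf] at hv' hw'
      rcases hv' with rfl | rfl <;> rcases hw' with rfl | rfl
      · exact .refl
      · exact .single hedge
      · exact .single hedge.symm
      · exact .refl
  · by_contra hcon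
    -- The subcells with a vertex reachable from `v` and those with an unreachable vertex form two
    -- closed sets that cover the connected frontier. They meet, and a vertex common to a subcell of
    -- each kind gives the contradiction.
    have hpre := isPreconnected_closed_iff.1 (hcell.isPreconnected_frontier h2)
    let S := {c' ∈ A.cells | c' ⊂ c ∧ ∃ u ∈ c', {u} ∈ A.cells ∧ Relation.ReflTransGen A.IsEdge v u}
    let S' := {c' ∈ A.cells | c' ⊂ c ∧
      ∃ u ∈ c', {u} ∈ A.cells ∧ ¬ Relation.ReflTransGen A.IsEdge v u}
    have hclosed : ∀ s ⊆ A.cells, IsClosed (⋃ c' ∈ s, c') := fun s hs =>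
      (A.finite_cells.subset hs).isClosed_biUnion fun c' hc' => (A.isFlatCell c' (hs hc')).isClosed
    have hsing : ∀ u ∈ c, {u} ∈ A.cells → {u} ⊂ c := by
      intro u hu hu'
      refine (Set.singleton_subset_iff.2 hu).ssubset_of_ne ?_
      rintro rfl
      rw [cellDim_singleton] at h2
      omega
    obtain ⟨x, -, hx1, hx2⟩ := hpre (⋃ c' ∈ S, c') (⋃ c' ∈ S', c') (hclosed _ fun _ h => h.1)
      (hclosed _ fun _ h => h.1) (by
        intro x hx
        rw [A.frontier_eq c hc] at hx
        simp only [Set.mem_ofPred_eq, Set.mem_iUnion, exists_prop] at hx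
        obtain ⟨c', ⟨hc', hlt⟩, hxc⟩ := hx
        obtain ⟨u, hu, hu'⟩ := A.exists_vertex hc'
        by_cases hvu : Relation.ReflTransGen A.IsEdge v u
        · exact Or.inl (Set.mem_biUnion (show c' ∈ S from ⟨hc', hlt, u, hu, hu', hvu⟩) hxc)
        · exact Or.inr (Set.mem_biUnion (show c' ∈ S' from ⟨hc', hlt, u, hu, hu', hvu⟩) hxc))
      ⟨v, A.mem_frontier_of_vertex hc (by omega) hv hvc, Set.mem_biUnion
        (show {v} ∈ S from ⟨hv, hsing v hvc hv, v, rfl, hv, .refl⟩) rfl⟩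
      ⟨w, A.mem_frontier_of_vertex hc (by omega) hw hwc, Set.mem_biUnion
        (show {w} ∈ S' from ⟨hw, hsing w hwc hw, w, rfl, hw, hcon⟩) rfl⟩
    simp only [Set.mem_iUnion, exists_prop] at hx1 hx2
    obtain ⟨c₁, ⟨hc₁, hlt₁, u₁, hu₁, hu₁', hr₁⟩, hxc₁⟩ := hx1
    obtain ⟨c₂, ⟨hc₂, hlt₂, u₂, hu₂, hu₂', hr₂⟩, hxc₂⟩ := hx2
    obtain ⟨e₁, he₁, hle₁, hxe₁⟩ := A.exists_mem_intrinsicInterior hc₁ hxc₁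
    obtain ⟨e₂, he₂, hle₂, hxe₂⟩ := A.exists_mem_intrinsicInterior hc₂ hxc₂
    -- Relative interiors of distinct cells are disjoint, so the cell carrying the common point `x`
    -- is a face of both `c₁` and `c₂`.
    have heq : e₁ = e₂ := by
      by_contra hne
      exact Set.disjoint_left.1 (A.disjoint_interiors e₁ he₁ e₂ he₂ hne) hxe₁ hxe₂
    subst heq
    obtain ⟨u, hu, hu'⟩ := A.exists_vertex he₁
    exact hr₂ ((hr₁.trans (ih c₁ hc₁ hlt₁ hu₁' hu' hu₁ (hle₁ hu))).trans
      (ih c₂ hc₂ hlt₂ hu' hu₂' (hle₂ hu) hu₂))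

theorem isCompact_body : IsCompact A.body := (A.isFlatCell _ A.body_mem).isCompact

theorem intrinsicInterior_body : intrinsicInterior ℝ A.body = interior A.body := by
  refine Set.Subset.antisymm ?_ interior_subset_intrinsicInterior
  have hspan : affineSpan ℝ A.body = ⊤ := by
    rw [AffineSubspace.affineSpan_eq_top_iff_vectorSpan_eq_top_of_nonempty ℝ _ _ A.body_nonempty]
    apply Submodule.eq_top_of_finrank_eq
    rw [finrank_euclideanSpace_fin]
    exact A.cellDim_body
  have hopen : IsOpen (affineSpan ℝ A.body : Set (E d)) := by simp [hspan]
  exact (hopen.isOpenMap_subtype_val.image_interior_subset _).trans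
    (interior_mono (Set.image_preimage_subset _ _))

theorem body_subset_closure_interior : A.body ⊆ closure (interior A.body) := by
  rw [← intrinsicInterior_body]
  exact (A.isFlatCell _ A.body_mem).subset_closure_interior

theorem interior_body_nonempty : (interior A.body).Nonempty :=
  closure_nonempty_iff.1 (A.body_nonempty.mono A.body_subset_closure_interior)

end Polyhedron

section TilingGeometry

variable {d : ℕ} {𝒜 : Type*} {P : 𝒜 → Polyhedron d}

/-! ### Regions and balls -/

theorem mem_region {t : 𝒜 × E d} {p : E d} : p ∈ region P t ↔ p - t.2 ∈ (P t.1).body := by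
  rw [region, Set.mem_vadd_set_iff_neg_vadd_mem, vadd_eq_add, neg_add_eq_sub]

theorem isCompact_region (t : 𝒜 × E d) : IsCompact (region P t) :=
  (P t.1).isCompact_body.vadd _

theorem region_nonempty (t : 𝒜 × E d) : (region P t).Nonempty :=
  (P t.1).body_nonempty.vadd_set

/-- The tile `t` meets the closed ball of radius `r` around the origin. -/
def HitsBall (P : 𝒜 → Polyhedron d) (t : 𝒜 × E d) (r : ℝ) : Prop :=
  (region P t ∩ Metric.closedBall 0 r).Nonempty

theorem HitsBall.mono {t : 𝒜 × E d} {r r' : ℝ} (h : HitsBall P t r) (hr : r ≤ r') :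
    HitsBall P t r' :=
  Set.Nonempty.mono (Set.inter_subset_inter_right _ (Metric.closedBall_subset_closedBall hr)) h

theorem exists_hitsBall (P : 𝒜 → Polyhedron d) (t : 𝒜 × E d) : ∃ r, HitsBall P t r := by
  obtain ⟨p, hp⟩ := region_nonempty (P := P) t
  exact ⟨‖p‖, p, hp, by simp⟩

theorem HitsBall.vadd {t : 𝒜 × E d} {r : ℝ} (h : HitsBall P t r) (z : E d) :
    HitsBall P (t.1, z + t.2) (r + ‖z‖) := by
  obtain ⟨p, hp, hr⟩ := h
  rw [mem_closedBall_zero_iff] at hr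
  refine ⟨z + p, ?_, ?_⟩
  · rw [mem_region] at hp ⊢
    simpa using hp
  · rw [mem_closedBall_zero_iff]
    linarith [norm_add_le z p]

theorem exists_region_subset (t : 𝒜 × E d) : ∃ r, region P t ⊆ Metric.closedBall 0 r :=
  (isCompact_region t).isBounded.subset_closedBall 0

/-- Take the cells whose relative interiors contain a common point. Contact of tiles thus becomes
coincidence of cells, which a correspondence of tilings preserves. -/
theorem exists_common_cell {X : Tiling P} {t s : 𝒜 × E d} (ht : t ∈ X.tiles) (hs : s ∈ X.tiles)
    (h : (region P t ∩ region P s).Nonempty) :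
    ∃ c ∈ (P t.1).cells, ∃ c' ∈ (P s.1).cells, t.2 +ᵥ c = s.2 +ᵥ c' := by
  obtain ⟨p, hp, hp'⟩ := h
  rw [mem_region] at hp hp'
  obtain ⟨c, hc, -, hpc⟩ := (P t.1).exists_mem_intrinsicInterior (P t.1).body_mem hp
  obtain ⟨c', hc', -, hpc'⟩ := (P s.1).exists_mem_intrinsicInterior (P s.1).body_mem hp'
  refine ⟨c, hc, c', hc', X.face_to_face t ht s hs c hc c' hc' ⟨p, ?_, ?_⟩⟩
  · exact Set.mem_vadd_set.2 ⟨_, hpc, by simp⟩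
  · exact Set.mem_vadd_set.2 ⟨_, hpc', by simp⟩

theorem exists_body_subset [Finite 𝒜] (P : 𝒜 → Polyhedron d) :
    ∃ ρ, ∀ a, (P a).body ⊆ Metric.closedBall 0 ρ := by
  have h : Bornology.IsBounded (⋃ a, (P a).body) :=
    Bornology.isBounded_iUnion.2 fun a => (P a).isCompact_body.isBounded
  obtain ⟨ρ, hρ⟩ := h.subset_closedBall 0
  exact ⟨ρ, fun a => (Set.subset_iUnion (fun a => (P a).body) a).trans hρ⟩

/-- If the interior of a prototile contains a ball of radius `ε`, tiles of that type lie at distance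
at least `ε` from each other. Only boundedly placed tiles meet the ball, and there are finitely many
types. -/
theorem Tiling.finite_hitsBall [Finite 𝒜] (X : Tiling P) (r : ℝ) :
    {t ∈ X.tiles | HitsBall P t r}.Finite := by
  obtain ⟨ρ, hρ⟩ := exists_body_subset P
  have key : ∀ a, {x : E d | (a, x) ∈ X.tiles ∧ HitsBall P (a, x) r}.Finite := by
    intro a
    obtain ⟨y, hy⟩ := (P a).interior_body_nonempty
    obtain ⟨ε, hε, hball⟩ := Metric.isOpen_iff.1 isOpen_interior y hy
    have hsep : ∀ x x' : E d, (a, x) ∈ X.tiles → (a, x') ∈ X.tiles → dist x x' < ε → x = x' := by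
      intro x x' hx hx' hd
      by_contra hne
      have hdis := X.disjoint _ hx _ hx' (by simpa using hne)
      refine Set.disjoint_left.1 hdis (Set.mem_vadd_set.2 ⟨y, hy, rfl⟩)
        (Set.mem_vadd_set.2 ⟨y + (x - x'), hball ?_, ?_⟩)
      · simpa [dist_eq_norm] using hd
      · simp only [vadd_eq_add]
        abel
    have hbdd : TotallyBounded {x : E d | (a, x) ∈ X.tiles ∧ HitsBall P (a, x) r} := by
      refine ((isCompact_closedBall (0 : E d) (r + ρ)).totallyBounded).subset ?_
      rintro x ⟨-, p, hp, hpr⟩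
      have h1 := hρ a (mem_region.1 hp)
      simp only [mem_closedBall_zero_iff] at h1 hpr ⊢
      calc ‖x‖ = ‖p - (p - x)‖ := by simp
        _ ≤ ‖p‖ + ‖p - x‖ := norm_sub_le _ _
        _ ≤ r + ρ := add_le_add hpr h1
    obtain ⟨s, hs, hcov⟩ := Metric.totallyBounded_iff.1 hbdd (ε / 2) (half_pos hε)
    refine Set.Finite.subset (hs.biUnion (t := fun y => {x : E d | (a, x) ∈ X.tiles ∧
      HitsBall P (a, x) r} ∩ Metric.ball y (ε / 2)) fun y _ => Set.Subsingleton.finite ?_) ?_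
    · rintro x ⟨hx, hxy⟩ x' ⟨hx', hxy'⟩
      refine hsep x x' hx.1 hx'.1 ?_
      calc dist x x' ≤ dist x y + dist x' y := dist_triangle_right _ _ _
        _ < ε / 2 + ε / 2 := add_lt_add hxy hxy'
        _ = ε := add_halves ε
    · intro x hx
      obtain ⟨y, hy, hxy⟩ := Set.mem_iUnion₂.1 (hcov hx)
      exact Set.mem_biUnion hy ⟨hx, hxy⟩
  refine Set.Finite.subset (Set.finite_iUnion fun a => (key a).image (Prod.mk a)) ?_
  rintro ⟨a, x⟩ hx
  exact Set.mem_iUnion.2 ⟨a, x, hx, rfl⟩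

/-! ### Agreement of tilings on balls -/

theorem AgreeOnBall.symm {X Y : Tiling P} {r : ℝ} (h : AgreeOnBall X Y r) : AgreeOnBall Y X r :=
  fun t ht => (h t ht).symm

theorem AgreeOnBall.mono {X Y : Tiling P} {r r' : ℝ} (h : AgreeOnBall X Y r) (hr : r' ≤ r) :
    AgreeOnBall X Y r' :=
  fun t ht => h t (HitsBall.mono ht hr)

theorem AgreeOnBall.trans {X Y Z : Tiling P} {r : ℝ} (h : AgreeOnBall X Y r)
    (h' : AgreeOnBall Y Z r) : AgreeOnBall X Z r :=
  fun t ht => (h t ht).trans (h' t ht)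

theorem AgreeOnBall.vadd {X Y : Tiling P} {r r' : ℝ} (z : E d) (h : AgreeOnBall X Y r)
    (hr : r' + ‖z‖ ≤ r) : AgreeOnBall (z +ᵥ X) (z +ᵥ Y) r' := by
  intro t ht
  refine h (t.1, -z + t.2) ?_
  refine HitsBall.mono (HitsBall.vadd ht (-z)) ?_
  rwa [norm_neg]

/-- All tiles of `X` that meet the closed ball of radius `r` are tiles of `Y`. -/
def PatchSubset (X Y : Tiling P) (r : ℝ) : Prop :=
  ∀ t ∈ X.tiles, HitsBall P t r → t ∈ Y.tiles

theorem AgreeOnBall.patchSubset {X Y : Tiling P} {r : ℝ} (h : AgreeOnBall X Y r) :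
    PatchSubset X Y r :=
  fun t ht hr => (h t hr).1 ht

theorem PatchSubset.mono {X Y : Tiling P} {r r' : ℝ} (h : PatchSubset X Y r) (hr : r' ≤ r) :
    PatchSubset X Y r' :=
  fun t ht hr' => h t ht (hr'.mono hr)

theorem region_subset_closure (t : 𝒜 × E d) :
    region P t ⊆ closure (t.2 +ᵥ interior (P t.1).body) := by
  rw [closure_vadd]
  exact Set.vadd_set_mono (P t.1).body_subset_closure_interior

/-- A tile of `Y` that meets the smaller ball has an interior point in the larger one. The tile of
`X` covering this point is also in `Y`, and overlapping tiles of `Y` are equal. -/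
theorem PatchSubset.agreeOnBall {X Y : Tiling P} {r r' : ℝ} (h : PatchSubset X Y r) (hr : r' < r) :
    AgreeOnBall X Y r' := by
  intro t ht
  refine ⟨fun htX => h t htX (HitsBall.mono ht hr.le), fun htY => ?_⟩
  obtain ⟨p, hp, hpr⟩ := ht
  obtain ⟨q, hq, hqp⟩ := Metric.mem_closure_iff.1 (region_subset_closure t hp) (r - r')
    (sub_pos.2 hr)
  obtain ⟨s, hs, hqs⟩ := X.cover q
  have hqr : q ∈ Metric.closedBall (0 : E d) r := by
    rw [mem_closedBall_zero_iff] at hpr ⊢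
    rw [dist_eq_norm] at hqp
    calc ‖q‖ = ‖p - (p - q)‖ := by simp
      _ ≤ ‖p‖ + ‖p - q‖ := norm_sub_le _ _
      _ ≤ r := by linarith
  have hsY := h s hs ⟨q, hqs, hqr⟩
  by_cases hts : t = s
  · rwa [hts]
  · exfalso
    obtain ⟨y, hyt, hys⟩ := mem_closure_iff.1 (region_subset_closure s hqs) _
      (isOpen_interior.vadd t.2) hq
    exact Set.disjoint_left.1 (Y.disjoint t htY s hsY hts) hyt hys

/-! ### The tiling topology -/

theorem Close.refl {ε : ℝ} (hε : 0 < ε) (X : Tiling P) : Close ε X X :=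
  ⟨0, by simpa using hε, fun t _ => by rw [zero_vadd]⟩

theorem Close.trans {ε δ : ℝ} (hδ : 0 < δ) (hδε : 2 * δ ≤ ε) (hδ1 : δ ≤ 1 / 2) {X Y Z : Tiling P}
    (h : Close δ X Y) (h' : Close δ Y Z) : Close ε X Z := by
  obtain ⟨u, hu, ha⟩ := h
  obtain ⟨u', hu', ha'⟩ := h'
  have hε : 0 < ε := by linarith
  -- Translating the first agreement by `u'` costs a radius of `δ`. One half of `1 / δ` bounds `1 /
  -- ε`, the other half bounds `δ`.
  have hle : 1 / ε + δ ≤ 1 / δ := by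
    have h1 : 1 / ε ≤ 1 / (2 * δ) := one_div_le_one_div_of_le (by linarith) hδε
    have h2 : 1 / δ = 1 / (2 * δ) + 1 / (2 * δ) := by field_simp; norm_num
    have h3 : δ ≤ 1 / (2 * δ) := by
      rw [le_div_iff₀ (by linarith)]
      nlinarith
    linarith
  refine ⟨u' + u, ?_, ?_⟩
  · linarith [norm_add_le u' u]
  · rw [add_vadd]
    exact (ha.vadd u' (by linarith)).trans (ha'.mono (by linarith))

/-- The topology is given by its open sets only. The points around which `U` contains a `Close`-ball
form an open set because `Close` is transitive up to a factor of two. -/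
theorem mem_nhds_iff_close {X : Tiling P} {U : Set (Tiling P)} :
    U ∈ nhds X ↔ ∃ ε > 0, ∀ Y, Close ε X Y → Y ∈ U := by
  constructor
  · intro h
    obtain ⟨V, hVU, hV, hX⟩ := mem_nhds_iff.1 h
    obtain ⟨ε, hε, hY⟩ := hV X hX
    exact ⟨ε, hε, fun Y h => hVU (hY Y h)⟩
  · rintro ⟨ε, hε, h⟩
    refine mem_nhds_iff.2 ⟨{Y | ∃ δ > 0, ∀ Z, Close δ Y Z → Z ∈ U}, ?_, ?_, ε, hε, h⟩
    · rintro Y ⟨δ, hδ, hY⟩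
      exact hY Y (Close.refl hδ Y)
    · rintro Y ⟨δ, hδ, hY⟩
      have hm : 0 < min (δ / 2) (1 / 2) := lt_min (by linarith) (by norm_num)
      refine ⟨min (δ / 2) (1 / 2), hm, fun Z hZ => ⟨min (δ / 2) (1 / 2), hm, fun W hW =>
        hY W (hZ.trans hm ?_ (min_le_right _ _) hW)⟩⟩
      linarith [min_le_left (δ / 2) (1 / 2)]

theorem exists_pos_le_one_div_sub (R ε : ℝ) (hε : 0 < ε) :
    ∃ δ > 0, δ ≤ ε ∧ R ≤ 1 / δ - δ := by
  refine ⟨min (min ε 1) (1 / (|R| + 1)), by positivity,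
    (min_le_left _ _).trans (min_le_left _ _), ?_⟩
  set δ := min (min ε 1) (1 / (|R| + 1))
  have hδ : 0 < δ := by positivity
  have h1 : δ ≤ 1 := (min_le_left _ _).trans (min_le_right _ _)
  have h2 : |R| + 1 ≤ 1 / δ := by
    rw [le_div_iff₀ hδ, mul_comm, ← le_div_iff₀ (by positivity)]
    exact min_le_right _ _
  linarith [le_abs_self R]

/-- Every tile of `X` occurs in `Y` after arbitrarily small shifts. Only finitely many tiles of `Y`
are nearby, so nonzero shifts are bounded away from zero and the shift `0` must occur. -/
theorem subset_of_forall_close [Finite 𝒜] {X Y : Tiling P} (h : ∀ ε > 0, Close ε X Y) :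
    X.tiles ⊆ Y.tiles := by
  intro t ht
  by_contra hY
  obtain ⟨r, hr⟩ := exists_hitsBall P t
  set S := (fun s : 𝒜 × E d => s.2 - t.2) '' {s ∈ Y.tiles | s.1 = t.1 ∧ HitsBall P s (r + 1)}
  have hS : S.Finite := by
    refine Set.Finite.image _ ((Y.finite_hitsBall (r + 1)).subset ?_)
    rintro s ⟨hs, -, hs'⟩
    exact ⟨hs, hs'⟩
  have h0 : (0 : E d) ∈ Sᶜ := by
    rintro ⟨s, ⟨hs, hs1, -⟩, hs2⟩
    have : s = t := Prod.ext hs1 (sub_eq_zero.1 hs2)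
    exact hY (this ▸ hs)
  obtain ⟨δ, hδ, hball⟩ := Metric.isOpen_iff.1 hS.isClosed.isOpen_compl 0 h0
  obtain ⟨ε, hε, hεδ, hεr⟩ := exists_pos_le_one_div_sub (r + 1) (min δ 1) (by positivity)
  obtain ⟨u, hu, ha⟩ := h ε hε
  have hhit : HitsBall P (t.1, u + t.2) (r + 1) := (hr.vadd u).mono (by
    linarith [min_le_right δ 1])
  have hmem : (t.1, u + t.2) ∈ Y.tiles :=
    (ha _ (hhit.mono (by linarith))).1 (by simpa [Tiling.mem_vadd] using ht)
  refine hball (a := u) (by simpa using hu.trans_le (hεδ.trans (min_le_left _ _)))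
    ⟨_, ⟨hmem, rfl, hhit⟩, by simp⟩

theorem Close.symm {X Y : Tiling P} {ε : ℝ} (hε : 0 < ε) (hε1 : ε ≤ 1 / 2)
    (h : Close ε X Y) : Close (2 * ε) Y X := by
  obtain ⟨u, hu, ha⟩ := h
  refine ⟨-u, by rw [norm_neg]; linarith, ?_⟩
  have h1 := ha.symm.vadd (r' := 1 / (2 * ε)) (-u) (by
    rw [norm_neg]
    have h2 : 1 / ε = 1 / (2 * ε) + 1 / (2 * ε) := by field_simp; norm_num
    have h3 : ε ≤ 1 / (2 * ε) := by
      rw [le_div_iff₀ (by linarith)]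
      nlinarith
    linarith)
  rwa [neg_vadd_vadd] at h1

theorem eq_of_forall_close [Finite 𝒜] {X Y : Tiling P} (h : ∀ ε > 0, Close ε X Y) : X = Y := by
  refine Tiling.ext ((subset_of_forall_close h).antisymm (subset_of_forall_close fun ε hε => ?_))
  have hm : 0 < min (ε / 2) (1 / 2) := lt_min (by linarith) (by norm_num)
  refine ((h _ hm).symm hm (min_le_right _ _)).mono (by linarith) ?_
  linarith [min_le_left (ε / 2) (1 / 2)]

theorem Close.exists_agreeOnBall {X Y : Tiling P} {ε : ℝ} (h : Close ε X Y) :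
    ∃ u : E d, ‖u‖ < ε ∧ AgreeOnBall X (-u +ᵥ Y) (1 / ε - ε) := by
  obtain ⟨u, hu, ha⟩ := h
  refine ⟨u, hu, ?_⟩
  have h1 := ha.vadd (r' := 1 / ε - ε) (-u) (by rw [norm_neg]; linarith)
  rwa [neg_vadd_vadd] at h1

/-- Minimality makes the orbit of `X₀` dense, and the small translation allowed by the topology is
absorbed into `z`. Agreement is therefore exact. -/
theorem TilingSpace.exists_agreeOnBall (T : TilingSpace P) {X X₀ : Tiling P} (hX : X ∈ T.carrier)
    (hX₀ : X₀ ∈ T.carrier) (R : ℝ) : ∃ z : E d, AgreeOnBall X (z +ᵥ X₀) R := by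
  obtain ⟨ε, hε, -, hR⟩ := exists_pos_le_one_div_sub R 1 one_pos
  obtain ⟨Y, hY, z, rfl⟩ := mem_closure_iff_nhds.1 (T.minimal X₀ hX₀ hX) {Y | Close ε X Y}
    (mem_nhds_iff_close.2 ⟨ε, hε, fun _ h => h⟩)
  obtain ⟨u, -, h⟩ := Close.exists_agreeOnBall (show Close ε X (z +ᵥ X₀) from hY)
  refine ⟨-u + z, ?_⟩
  rw [add_vadd]
  exact h.mono hR

/-! ### Connectedness -/

/-- Two tiles of a tiling that share a cell. -/
def Touch (X : Tiling P) (t s : 𝒜 × E d) : Prop :=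
  t ∈ X.tiles ∧ s ∈ X.tiles ∧ ∃ c ∈ (P t.1).cells, ∃ c' ∈ (P s.1).cells, t.2 +ᵥ c = s.2 +ᵥ c'

theorem Tiling.isClosed_biUnion_region [Finite 𝒜] (X : Tiling P) {S : Set (𝒜 × E d)}
    (hS : S ⊆ X.tiles) : IsClosed (⋃ t ∈ S, region P t) := by
  rw [Set.biUnion_eq_iUnion]
  refine LocallyFinite.isClosed_iUnion ?_ fun t => (isCompact_region _).isClosed
  intro p
  refine ⟨Metric.closedBall 0 (‖p‖ + 1), ?_, ?_⟩
  · refine Filter.mem_of_superset (Metric.ball_mem_nhds p one_pos) fun q hq => ?_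
    rw [mem_closedBall_zero_iff]
    rw [Metric.mem_ball, dist_eq_norm] at hq
    linarith [norm_sub_norm_le q p]
  · refine Set.Finite.of_finite_image (f := Subtype.val)
      ((X.finite_hitsBall (‖p‖ + 1)).subset ?_) Subtype.val_injective.injOn
    rintro _ ⟨t, ht, rfl⟩
    exact ⟨hS t.2, ht⟩

/-- By local finiteness, the tiles reachable from `t` and the remaining tiles cover closed sets. As
`ℝ^d` is connected these sets meet, and tiles with a common point share a cell. -/
theorem Tiling.reflTransGen_touch [Finite 𝒜] (X : Tiling P) {t s : 𝒜 × E d} (ht : t ∈ X.tiles)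
    (hs : s ∈ X.tiles) : Relation.ReflTransGen (Touch X) t s := by
  by_contra hcon
  let S := {r ∈ X.tiles | Relation.ReflTransGen (Touch X) t r}
  let S' := {r ∈ X.tiles | ¬ Relation.ReflTransGen (Touch X) t r}
  obtain ⟨p, hp⟩ := region_nonempty (P := P) t
  obtain ⟨q, hq⟩ := region_nonempty (P := P) s
  obtain ⟨x, -, hx, hx'⟩ := isPreconnected_closed_iff.1 (isPreconnected_univ (α := E d))
    (⋃ r ∈ S, region P r) (⋃ r ∈ S', region P r) (X.isClosed_biUnion_region fun _ h => h.1)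
    (X.isClosed_biUnion_region fun _ h => h.1) (by
      intro y _
      obtain ⟨r, hr, hy⟩ := X.cover y
      by_cases h : Relation.ReflTransGen (Touch X) t r
      · exact Or.inl (Set.mem_biUnion (show r ∈ S from ⟨hr, h⟩) hy)
      · exact Or.inr (Set.mem_biUnion (show r ∈ S' from ⟨hr, h⟩) hy))
    ⟨p, trivial, Set.mem_biUnion (show t ∈ S from ⟨ht, .refl⟩) hp⟩
    ⟨q, trivial, Set.mem_biUnion (show s ∈ S' from ⟨hs, hcon⟩) hq⟩
  obtain ⟨r, ⟨hr, hrt⟩, hxr⟩ := Set.mem_iUnion₂.1 hx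
  obtain ⟨r', ⟨hr', hrt'⟩, hxr'⟩ := Set.mem_iUnion₂.1 hx'
  have hcell := exists_common_cell hr hr' ⟨x, hxr, hxr'⟩
  exact hrt' (hrt.tail ⟨hr, hr', hcell⟩)

/-- Two points of `X` are joined by an edge. -/
def EdgeStep (T : TilingSpace P) (X : Tiling P) (p q : E d) : Prop :=
  ∃ e : EdgeIn T, e.X = X ∧ e.src.pos = p ∧ e.tgt.pos = q

theorem nonempty_edgePath {T : TilingSpace P} {X : Tiling P} {p q : E d}
    (h : Relation.ReflTransGen (EdgeStep T X) p q) : Nonempty (EdgePath T X p q) := by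
  induction h with
  | refl => exact ⟨.nil _⟩
  | tail _ h ih =>
    obtain ⟨e, h1, h2, h3⟩ := h
    exact ih.map fun γ => .cons γ e h1 h2 h3

theorem reflTransGen_edgeStep_of_tile {T : TilingSpace P} {X : Tiling P} (hX : X ∈ T.carrier)
    {t : 𝒜 × E d} (ht : t ∈ X.tiles) {v w : E d} (hv : {v} ∈ (P t.1).cells)
    (hw : {w} ∈ (P t.1).cells) : Relation.ReflTransGen (EdgeStep T X) (t.2 + v) (t.2 + w) := by
  have h := (P t.1).reflTransGen_isEdge (P t.1).body_mem hv hw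
    ((P t.1).subset_body _ hv rfl) ((P t.1).subset_body _ hw rfl)
  exact h.lift (t.2 + ·) fun a b hab => ⟨⟨X, hX, t, ht, a, b, hab⟩, rfl, rfl, rfl⟩

theorem TilingSpace.nonempty_edgePath [Finite 𝒜] (T : TilingSpace P) {X : Tiling P}
    (hX : X ∈ T.carrier) {p q : E d} (hp : X.IsVertex p) (hq : X.IsVertex q) :
    Nonempty (EdgePath T X p q) := by
  obtain ⟨t, ht, v, hv, rfl⟩ := hp
  obtain ⟨s, hs, w, hw, rfl⟩ := hq
  apply TilingDeformation.nonempty_edgePath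
  have h := X.reflTransGen_touch ht hs
  clear hs
  induction h generalizing w with
  | refl => exact reflTransGen_edgeStep_of_tile hX ht hv hw
  | tail _ htouch ih =>
    obtain ⟨hb, hc, c, hcc, c', hcc', heq⟩ := htouch
    rename_i b r _
    obtain ⟨u, huc, hu⟩ := (P b.1).exists_vertex hcc
    have hpos : b.2 + u ∈ r.2 +ᵥ c' := by
      rw [← heq]
      exact Set.mem_vadd_set.2 ⟨u, huc, rfl⟩
    obtain ⟨y, hy, hyu⟩ := Set.mem_vadd_set.1 hpos
    -- The point `u` is known to be a vertex of `b` only. The cell of `r` with this point in its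
    -- relative interior coincides with `{u}`, so the point is a vertex of `r` too.
    obtain ⟨c₁, hc₁, -, hy₁⟩ := (P r.1).exists_mem_intrinsicInterior hcc' hy
    have h1 := X.face_to_face b hb r hc {u} hu c₁ hc₁ ⟨b.2 + u, by simp,
      Set.mem_vadd_set.2 ⟨y, hy₁, hyu⟩⟩
    have h2 : c₁ = {y} := by
      refine (Set.Subsingleton.eq_singleton_of_mem ?_ (intrinsicInterior_subset hy₁))
      have h3 : (r.2 +ᵥ c₁).Subsingleton := by
        rw [← h1]
        simp
      intro a ha a' ha'
      exact add_left_cancel (h3 (Set.mem_vadd_set.2 ⟨a, ha, rfl⟩) (Set.mem_vadd_set.2 ⟨a', ha', rfl⟩))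
    rw [h2] at hc₁
    refine (ih u hu).trans ?_
    rw [← hyu, vadd_eq_add]
    exact reflTransGen_edgeStep_of_tile hX hc hc₁ hw

end TilingGeometry

/-! ### Combinatorial correspondences and their locality -/

section Correspondence

variable {d : ℕ} {𝒜 : Type*} {P Q : 𝒜 → Polyhedron d}

/-- A correspondence between the tiles of `X` and `Y` that witnesses that these tilings have the same
combinatorics: the tile `t` of `X` corresponds to the tile of `Y` of the same type at `toFun t`. -/
structure Corr (Φ : ∀ a, (P a).cells ≃o (Q a).cells) (X : Tiling P) (Y : Tiling Q) where
  toFun : 𝒜 × E d → E d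
  invFun : 𝒜 × E d → E d
  map_mem : ∀ t ∈ X.tiles, (t.1, toFun t) ∈ Y.tiles
  inv_mem : ∀ y ∈ Y.tiles, (y.1, invFun y) ∈ X.tiles
  left_inv : ∀ t ∈ X.tiles, invFun (t.1, toFun t) = t.2
  right_inv : ∀ y ∈ Y.tiles, toFun (y.1, invFun y) = y.2
  cell_iff : ∀ t ∈ X.tiles, ∀ s ∈ X.tiles, ∀ (c : (P t.1).cells) (c' : (P s.1).cells),
    t.2 +ᵥ (c : Set (E d)) = s.2 +ᵥ (c' : Set (E d)) ↔
      toFun t +ᵥ (Φ _ c : Set (E d)) = toFun s +ᵥ (Φ _ c' : Set (E d))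

variable {Φ : ∀ a, (P a).cells ≃o (Q a).cells} {X : Tiling P} {Y : Tiling Q}

theorem SameCombinatorics.nonempty_corr (h : SameCombinatorics Φ X Y) : Nonempty (Corr Φ X Y) := by
  classical
  obtain ⟨σ, h1, h2⟩ := h
  have h1' : ∀ y : Y.tiles, (σ.symm y).1.1 = y.1.1 := by
    intro y
    rw [← h1 (σ.symm y), σ.apply_symm_apply]
  have e1 : ∀ t : X.tiles, (t.1.1, (σ t).1.2) = (σ t).1 := fun t => Prod.ext (h1 t).symm rfl
  have e2 : ∀ y : Y.tiles, (y.1.1, (σ.symm y).1.2) = (σ.symm y).1 :=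
    fun y => Prod.ext (h1' y).symm rfl
  refine ⟨{
    toFun := fun t => if h : t ∈ X.tiles then (σ ⟨t, h⟩).1.2 else 0
    invFun := fun y => if h : y ∈ Y.tiles then (σ.symm ⟨y, h⟩).1.2 else 0
    map_mem := ?_
    inv_mem := ?_
    left_inv := ?_
    right_inv := ?_
    cell_iff := ?_ }⟩
  · intro t ht
    rw [dif_pos ht, e1 ⟨t, ht⟩]
    exact (σ _).2
  · intro y hy
    rw [dif_pos hy, e2 ⟨y, hy⟩]
    exact (σ.symm _).2
  · intro t ht
    simp only [dif_pos ht, e1 ⟨t, ht⟩, dif_pos (σ ⟨t, ht⟩).2, Subtype.coe_eta,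
      Equiv.symm_apply_apply]
  · intro y hy
    simp only [dif_pos hy, e2 ⟨y, hy⟩, dif_pos (σ.symm ⟨y, hy⟩).2, Subtype.coe_eta,
      Equiv.apply_symm_apply]
  · intro t ht s hs c c'
    rw [dif_pos ht, dif_pos hs]
    exact h2 ⟨t, ht⟩ ⟨s, hs⟩ c c'

namespace Corr

theorem sameCombinatorics (m : Corr Φ X Y) : SameCombinatorics Φ X Y :=
  ⟨{ toFun := fun t => ⟨(t.1.1, m.toFun t.1), m.map_mem _ t.2⟩
     invFun := fun y => ⟨(y.1.1, m.invFun y.1), m.inv_mem _ y.2⟩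
     left_inv := fun t => Subtype.ext (Prod.ext rfl (m.left_inv _ t.2))
     right_inv := fun y => Subtype.ext (Prod.ext rfl (m.right_inv _ y.2)) },
    fun _ => rfl, fun t s => m.cell_iff t.1 t.2 s.1 s.2⟩

/-- The inverse correspondence. -/
def symm (m : Corr Φ X Y) : Corr (fun a => (Φ a).symm) Y X where
  toFun := m.invFun
  invFun := m.toFun
  map_mem := m.inv_mem
  inv_mem := m.map_mem
  left_inv := m.right_inv
  right_inv := m.left_inv
  cell_iff := by
    intro y hy s hs c c'
    have h := m.cell_iff _ (m.inv_mem y hy) _ (m.inv_mem s hs) ((Φ y.1).symm c) ((Φ s.1).symm c')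
    rw [m.right_inv y hy, m.right_inv s hs] at h
    simpa using h.symm

/-- Translation of the target of a correspondence. -/
def vaddRight (m : Corr Φ X Y) (z : E d) : Corr Φ X (z +ᵥ Y) where
  toFun t := z + m.toFun t
  invFun y := m.invFun (y.1, -z + y.2)
  map_mem t ht := by
    rw [Tiling.mem_vadd, neg_add_cancel_left]
    exact m.map_mem t ht
  inv_mem y hy := m.inv_mem _ (Tiling.mem_vadd.1 hy)
  left_inv t ht := by
    simp only [neg_add_cancel_left]
    exact m.left_inv t ht
  right_inv y hy := by
    rw [m.right_inv _ (Tiling.mem_vadd.1 hy)]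
    exact add_neg_cancel_left _ _
  cell_iff t ht s hs c c' := by
    rw [m.cell_iff t ht s hs, add_vadd, add_vadd, (AddAction.injective z).eq_iff]

/-- Translation of the source of a correspondence. -/
def vaddLeft (m : Corr Φ X Y) (z : E d) : Corr Φ (z +ᵥ X) Y where
  toFun t := m.toFun (t.1, -z + t.2)
  invFun y := z + m.invFun y
  map_mem t ht := m.map_mem _ (Tiling.mem_vadd.1 ht)
  inv_mem y hy := by
    rw [Tiling.mem_vadd, neg_add_cancel_left]
    exact m.inv_mem y hy
  left_inv t ht := by
    rw [m.left_inv _ (Tiling.mem_vadd.1 ht)]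
    exact add_neg_cancel_left _ _
  right_inv y hy := by
    simp only [neg_add_cancel_left]
    exact m.right_inv y hy
  cell_iff t ht s hs c c' := by
    rw [← m.cell_iff _ (Tiling.mem_vadd.1 ht) _ (Tiling.mem_vadd.1 hs), add_vadd, add_vadd,
      (AddAction.injective (-z)).eq_iff]

/-- Corresponding tiles of tilings that agree on a large patch have the same relative positions. -/
theorem exists_sub_eq (m : Corr Φ X Y) {t₀ t : 𝒜 × E d} (ht₀ : t₀ ∈ X.tiles)
    (h : Relation.ReflTransGen (Touch X) t₀ t) :
    ∃ R, ∀ (X₂ : Tiling P) (Y₂ : Tiling Q) (m₂ : Corr Φ X₂ Y₂), PatchSubset X X₂ R →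
      t ∈ X₂.tiles ∧ m₂.toFun t - m₂.toFun t₀ = m.toFun t - m.toFun t₀ := by
  induction h with
  | refl =>
    obtain ⟨R, hR⟩ := exists_hitsBall P t₀
    exact ⟨R, fun X₂ Y₂ m₂ h => ⟨h _ ht₀ hR, by simp⟩⟩
  | tail _ htouch ih =>
    obtain ⟨R, hR⟩ := ih
    rename_i b s _
    obtain ⟨hb, hs, c, hc, c', hc', heq⟩ := htouch
    obtain ⟨R', hR'⟩ := exists_hitsBall P s
    refine ⟨max R R', fun X₂ Y₂ m₂ h => ?_⟩
    obtain ⟨hb₂, hsub⟩ := hR X₂ Y₂ m₂ (h.mono (le_max_left _ _))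
    have hs₂ := h _ hs (hR'.mono (le_max_right _ _))
    refine ⟨hs₂, ?_⟩
    have h1 := (m.cell_iff b hb s hs ⟨c, hc⟩ ⟨c', hc'⟩).1 heq
    have h2 := (m₂.cell_iff b hb₂ s hs₂ ⟨c, hc⟩ ⟨c', hc'⟩).1 heq
    have hcell := (Q s.1).isFlatCell _ (Φ s.1 ⟨c', hc'⟩).2
    -- The shared cell is placed by the tile `b`, and its place determines that of the tile `s`.
    have h3 : (m₂.toFun b - m.toFun b + m.toFun s) +ᵥ (Φ s.1 ⟨c', hc'⟩ : Set (E d)) =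
        m₂.toFun s +ᵥ (Φ s.1 ⟨c', hc'⟩ : Set (E d)) := by
      rw [← h2, add_vadd, ← h1, vadd_vadd, sub_add_cancel]
    have h4 := vadd_set_cancel hcell.isCompact hcell.nonempty h3
    rw [← h4]
    calc _ = (m₂.toFun b - m₂.toFun t₀) + m.toFun s - m.toFun b := by abel
      _ = _ := by rw [hsub]; abel

/-- If `X` and `X₂` agree on a large patch, then so do the corresponding tilings, up to the
translation that matches the tiles corresponding to a given tile. -/
theorem exists_patchSubset [Finite 𝒜] (m : Corr Φ X Y) {t₀ : 𝒜 × E d} (ht₀ : t₀ ∈ X.tiles)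
    (R' : ℝ) :
    ∃ R, ∀ (X₂ : Tiling P) (Y₂ : Tiling Q) (m₂ : Corr Φ X₂ Y₂), PatchSubset X X₂ R →
      t₀ ∈ X₂.tiles ∧ PatchSubset Y ((m.toFun t₀ - m₂.toFun t₀) +ᵥ Y₂) R' := by
  have key : ∀ y : 𝒜 × E d, ∃ R, y ∈ Y.tiles →
      ∀ (X₂ : Tiling P) (Y₂ : Tiling Q) (m₂ : Corr Φ X₂ Y₂), PatchSubset X X₂ R →
        (y.1, m.invFun y) ∈ X₂.tiles ∧ m₂.toFun (y.1, m.invFun y) - m₂.toFun t₀ =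
          m.toFun (y.1, m.invFun y) - m.toFun t₀ := by
    intro y
    by_cases hy : y ∈ Y.tiles
    · obtain ⟨R, hR⟩ := m.exists_sub_eq ht₀ (X.reflTransGen_touch ht₀ (m.inv_mem y hy))
      exact ⟨R, fun _ => hR⟩
    · exact ⟨0, fun h => absurd h hy⟩
  choose r hr using key
  -- Only finitely many tiles of `Y` meet the ball, so one radius serves for all of them.
  obtain ⟨B, hB⟩ := ((Y.finite_hitsBall R').image r).bddAbove
  obtain ⟨R₀, hR₀⟩ := exists_hitsBall P t₀
  refine ⟨max B R₀, fun X₂ Y₂ m₂ h => ⟨h _ ht₀ (hR₀.mono (le_max_right _ _)), fun y hy hhit => ?_⟩⟩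
  obtain ⟨h1, h2⟩ := hr y hy X₂ Y₂ m₂
    (h.mono ((hB ⟨y, ⟨hy, hhit⟩, rfl⟩).trans (le_max_left _ _)))
  rw [m.right_inv y hy] at h2
  have h3 := m₂.map_mem _ h1
  rw [Tiling.mem_vadd]
  convert h3 using 2
  rw [sub_eq_iff_eq_add] at h2
  simp only [h2]
  abel

end Corr

end Correspondence

/-! ### Vertices of realizations -/

section RealizationVertices

variable {d : ℕ} {𝒜 : Type*} {P : 𝒜 → Polyhedron d} {T : TilingSpace P} {f : Z1 T 0}

theorem Realization.exists_vertex (D : Realization T f) (a : 𝒜) (v : E d) :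
    ∃ v' : E d, ∀ h : {v} ∈ (P a).cells, (D.cellIso a ⟨{v}, h⟩ : Set (E d)) = {v'} := by
  by_cases h : {v} ∈ (P a).cells
  · obtain ⟨v', hv'⟩ := ((D.proto a).isFlatCell _ (D.cellIso a ⟨{v}, h⟩).2).eq_singleton
      (by rw [D.cellDim_eq, cellDim_singleton])
    exact ⟨v', fun _ => hv'⟩
  · exact ⟨0, fun hv => absurd hv h⟩

/-- The vertex of a deformed prototile that corresponds to the vertex `v` of a prototile. -/
noncomputable def Realization.vert (D : Realization T f) (a : 𝒜) (v : E d) : E d :=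
  (D.exists_vertex a v).choose

theorem Realization.cellIso_singleton (D : Realization T f) {a : 𝒜} {v : E d}
    (h : {v} ∈ (P a).cells) : (D.cellIso a ⟨{v}, h⟩ : Set (E d)) = {D.vert a v} :=
  (D.exists_vertex a v).choose_spec h

/-- The position in the deformed tiling of the vertex `v` of the tile `t`. -/
noncomputable def Corr.vertPos {D : Realization T f} {X : Tiling P} {Y : Tiling D.proto}
    (m : Corr D.cellIso X Y) (t : 𝒜 × E d) (v : E d) : E d :=
  m.toFun t + D.vert t.1 v

variable {D : Realization T f} {X : Tiling P} {Y : Tiling D.proto}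

theorem Corr.vertPos_eq (m : Corr D.cellIso X Y) {t s : 𝒜 × E d} (ht : t ∈ X.tiles)
    (hs : s ∈ X.tiles) {v w : E d} (hv : {v} ∈ (P t.1).cells) (hw : {w} ∈ (P s.1).cells)
    (h : t.2 + v = s.2 + w) : m.vertPos t v = m.vertPos s w := by
  have h1 := (m.cell_iff t ht s hs ⟨{v}, hv⟩ ⟨{w}, hw⟩).1 (by simp [h])
  rw [D.cellIso_singleton, D.cellIso_singleton] at h1
  simpa [Corr.vertPos] using h1

theorem Corr.vertPos_sub (m : Corr D.cellIso X Y) (e : EdgeIn T) :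
    m.vertPos e.t e.w - m.vertPos e.t e.v = f.1 (Edge.mk T 0 e) := by
  rw [← D.edge_eq e _ _ (D.cellIso_singleton _) (D.cellIso_singleton _)]
  simp [Corr.vertPos]

/-- The edge increments telescope, since the position of a vertex does not depend on the tile chosen
to name it. Existence of the deformed tiling thus makes the sums of `f` path independent. -/
theorem Corr.vertPos_sub_eval (m : Corr D.cellIso X Y) {p q : E d} (γ : EdgePath T X p q)
    {t s : 𝒜 × E d} (ht : t ∈ X.tiles) (hs : s ∈ X.tiles) {v w : E d} (hv : {v} ∈ (P t.1).cells)
    (hw : {w} ∈ (P s.1).cells) (hp : t.2 + v = p) (hq : s.2 + w = q) :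
    m.vertPos s w - m.vertPos t v = γ.eval f.1 := by
  induction γ generalizing s w with
  | nil =>
    rw [EdgePath.eval, m.vertPos_eq hs ht hw hv (hq.trans hp.symm), sub_self]
  | cons γ e hX hsrc htgt ih =>
    have het : e.t ∈ X.tiles := hX ▸ e.tile_mem
    have h1 := ih het e.edge.2.1 hsrc
    have h2 := m.vertPos_sub e
    have h3 : m.vertPos s w = m.vertPos e.t e.w :=
      m.vertPos_eq hs het hw e.edge.2.2.1 (hq.trans htgt.symm)
    rw [EdgePath.eval, ← h1, ← h2, h3]
    abel

end RealizationVertices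

/-! ### Locality of collars and the cohomological hypothesis -/

section VertexFunction

variable {d : ℕ} {𝒜 : Type*} {P : 𝒜 → Polyhedron d}

theorem sameCollar_vadd (X : Tiling P) (z : E d) (k : ℕ) (t : 𝒜 × E d) :
    SameCollar X (z +ᵥ X) k t (t.1, z + t.2) := by
  induction k generalizing t with
  | zero => rfl
  | succ k ih =>
    refine ⟨rfl, fun s hs _ => ?_, fun s hs _ => ?_⟩
    · have h : (s.1, s.2 + ((t.1, z + t.2).2 - t.2)) = (s.1, z + s.2) := by
        simp [add_comm]
      rw [h]
      exact ⟨by simpa [Tiling.mem_vadd] using hs, ih s⟩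
    · have h : (s.1, s.2 + (t.2 - (t.1, z + t.2).2)) = (s.1, -z + s.2) := by
        simp [add_comm, sub_eq_add_neg]
      rw [h]
      exact ⟨hs, by simpa using ih (s.1, -z + s.2)⟩

/-- A collar involves only the finitely many tiles that touch `t` and, inductively, their collars.
-/
theorem exists_sameCollar [Finite 𝒜] (X : Tiling P) (k : ℕ) (t : 𝒜 × E d) :
    ∃ R, ∀ X₂ : Tiling P, AgreeOnBall X X₂ R → SameCollar X X₂ k t t := by
  induction k generalizing t with
  | zero => exact ⟨0, fun _ _ => rfl⟩
  | succ k ih =>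
    choose r hr using ih
    obtain ⟨ρ, hρ⟩ := exists_region_subset (P := P) t
    obtain ⟨B, hB⟩ := ((X.finite_hitsBall ρ).image r).bddAbove
    refine ⟨max B ρ, fun X₂ h => ⟨rfl, fun s hs hts => ?_, fun s hs hts => ?_⟩⟩
    all_goals
      have hhit : HitsBall P s ρ := by
        obtain ⟨x, hx, hx'⟩ := hts
        exact ⟨x, hx', hρ hx⟩
      have hiff := h s (hhit.mono (le_max_right _ _))
      simp only [sub_self, add_zero, Prod.mk.eta]
    · exact ⟨hiff.1 hs, hr s X₂ (h.mono ((hB ⟨s, ⟨hs, hhit⟩, rfl⟩).trans (le_max_left _ _)))⟩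
    · have hs' := hiff.2 hs
      exact ⟨hs', hr s X₂ (h.mono ((hB ⟨s, ⟨hs', hhit⟩, rfl⟩).trans (le_max_left _ _)))⟩

variable {T : TilingSpace P}

/-- The image in `Γ^(k)` of a vertex of a tiling. -/
def VertexIn.image (k : ℕ) (p : VertexIn T) : Vertex T k := Quot.mk _ p

/-- The vertex of `X` that corresponds to `p` if `p.X` and `z +ᵥ X` agree near `p`. -/
def VertexIn.move (p : VertexIn T) {X : Tiling P} (hX : X ∈ T.carrier) (z : E d)
    (h : p.t ∈ (z +ᵥ X).tiles) : VertexIn T :=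
  ⟨X, hX, (p.t.1, -z + p.t.2), h, p.v, p.vertex⟩

theorem VertexIn.move_pos (p : VertexIn T) {X : Tiling P} (hX : X ∈ T.carrier) (z : E d)
    (h : p.t ∈ (z +ᵥ X).tiles) : (p.move hX z h).pos = p.pos - z := by
  simp only [VertexIn.move, VertexIn.pos]
  abel

/-- Agreement on a large ball preserves the `k`-collar of the tile, and collars are translation
invariant. Cochains on the vertices of `Γ^(k)` therefore depend only on the local pattern. -/
theorem VertexIn.exists_image_move_eq [Finite 𝒜] (p : VertexIn T) (k : ℕ) :
    ∃ R, ∀ (X : Tiling P) (hX : X ∈ T.carrier) (z : E d), AgreeOnBall p.X (z +ᵥ X) R →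
      ∃ h : p.t ∈ (z +ᵥ X).tiles, (p.move hX z h).image k = p.image k := by
  obtain ⟨R, hR⟩ := exists_sameCollar p.X k p.t
  obtain ⟨R', hR'⟩ := exists_hitsBall P p.t
  refine ⟨max R R', fun X hX z h => ?_⟩
  have ht := (h p.t (hR'.mono (le_max_right _ _))).1 p.tile_mem
  refine ⟨ht, ?_⟩
  let q : VertexIn T := ⟨z +ᵥ X, T.vadd_mem X hX z, p.t, ht, p.v, p.vertex⟩
  have h1 : p.image k = q.image k := Quot.sound (Or.inl ⟨hR _ (h.mono (le_max_left _ _)), rfl⟩)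
  have h2 : (p.move hX z ht).image k = q.image k := by
    refine Quot.sound (Or.inl ⟨?_, rfl⟩)
    have := sameCollar_vadd X z k (p.t.1, -z + p.t.2)
    simpa [VertexIn.move, q] using this
  rw [h1, h2]

/-- The difference of two shape functions with asymptotically negligible difference is the sum of a
cocycle that is small on large recurrences and a coboundary. -/
theorem exists_eq_add_coboundary {f g : Z1 T 0}
    (hfg : IsAsymptoticallyNegligible T (shapeClass T f - shapeClass T g)) :
    ∃ (k j : ℕ) (c : Edge T k → E d) (β : Vertex T j → E d),
      (∀ ε : ℝ, 0 < ε → ∃ R : ℝ≥0, ∀ X ∈ T.carrier, ∀ z₁ z₂ : E d, X.IsVertex z₁ →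
        X.IsVertex z₂ → (R : ℝ≥0∞) < recurrenceSize X z₁ z₂ →
          ∀ γ : EdgePath T X z₁ z₂, ‖γ.eval c‖ < ε) ∧
      ∀ e : EdgeIn T, f.1 (Edge.mk T 0 e) - g.1 (Edge.mk T 0 e) =
        c (Edge.mk T k e) + (β (e.tgt.image j) - β (e.src.image j)) := by
  obtain ⟨k, η, ⟨c, rfl, hc⟩, hk⟩ := hfg
  have hof : ∀ x : Z1 T 0, shapeClass T x =
      pullback T k (Submodule.Quotient.mk (pullbackZ1 T (Nat.zero_le k) x)) := fun x =>
    (Module.DirectLimit.of_f (G := H1 T) (f := pullbackH1 T) (hij := Nat.zero_le k)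
      (x := Submodule.Quotient.mk x)).symm
  have h0 : pullback T k (Submodule.Quotient.mk
      (pullbackZ1 T (Nat.zero_le k) f - pullbackZ1 T (Nat.zero_le k) g - c)) = 0 := by
    rw [Submodule.Quotient.mk_sub, Submodule.Quotient.mk_sub, map_sub, map_sub, ← hof, ← hof, hk,
      sub_self]
  have : DirectedSystem (H1 T) fun i j h => pullbackH1 T i j h := by
    refine ⟨fun i x => ?_, fun i j l hij hjl x => ?_⟩
    · induction x using Submodule.Quotient.induction_on with
      | H x =>
        refine congrArg Submodule.Quotient.mk (Subtype.ext (funext fun e => ?_))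
        induction e using Quot.ind with
        | mk e => rfl
    · induction x using Submodule.Quotient.induction_on with
      | H x =>
        refine congrArg Submodule.Quotient.mk (Subtype.ext (funext fun e => ?_))
        induction e using Quot.ind with
        | mk e => rfl
  -- A class that vanishes in the direct limit already vanishes at a finite stage, where it is the
  -- coboundary of some `β`.
  obtain ⟨j, hkj, hj⟩ := Module.DirectLimit.of.zero_exact h0
  have hj' : pullbackZ1 T hkj
      (pullbackZ1 T (Nat.zero_le k) f - pullbackZ1 T (Nat.zero_le k) g - c) ∈ B1 T j :=
    (Submodule.Quotient.mk_eq_zero _).1 hj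
  obtain ⟨β, hβ⟩ := hj'
  refine ⟨k, j, c.1, β, hc, fun e => ?_⟩
  have h1 : β (e.tgt.image j) - β (e.src.image j) =
      f.1 (Edge.mk T 0 e) - g.1 (Edge.mk T 0 e) - c.1 (Edge.mk T k e) :=
    congrFun hβ (Edge.mk T j e)
  rw [h1]
  abel

theorem EdgePath.eval_sub_eval {f g : Edge T 0 → E d} {k j : ℕ} {c : Edge T k → E d}
    {β : Vertex T j → E d}
    (h : ∀ e : EdgeIn T, f (Edge.mk T 0 e) - g (Edge.mk T 0 e) =
      c (Edge.mk T k e) + (β (e.tgt.image j) - β (e.src.image j)))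
    {X : Tiling P} {x y : E d} (γ : EdgePath T X x y) (p q : VertexIn T) (hp : p.X = X)
    (hq : q.X = X) (hpx : p.pos = x) (hqy : q.pos = y) :
    γ.eval f - γ.eval g = γ.eval c + (β (q.image j) - β (p.image j)) := by
  induction γ generalizing q with
  | nil =>
    have : q.image j = p.image j := Quot.sound (Or.inr ⟨hq.trans hp.symm, hqy.trans hpx.symm⟩)
    simp [EdgePath.eval, this]
  | cons γ e hX hsrc htgt ih =>
    have h1 := ih e.src hX hsrc
    have h2 := h e
    have h3 : q.image j = e.tgt.image j := Quot.sound (Or.inr ⟨hq.trans hX.symm, hqy.trans htgt.symm⟩)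
    simp only [EdgePath.eval, h3]
    calc _ = (γ.eval f - γ.eval g) + (f (Edge.mk T 0 e) - g (Edge.mk T 0 e)) := by abel
      _ = _ := by rw [h1, h2]; abel

/-! ### Transfer functions, obtained as limits along a dense orbit -/

/-- A continuous translation invariant function of the vertices of tilings whose coboundary is the
difference of the cochains `f` and `g`. -/
structure IsTransfer (T : TilingSpace P) (f g : Edge T 0 → E d) (b : Tiling P → E d → E d) :
    Prop where
  edge : ∀ e : EdgeIn T, b e.X e.tgt.pos - b e.X e.src.pos =
    f (Edge.mk T 0 e) - g (Edge.mk T 0 e)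
  cont : ∀ (p : VertexIn T) (ε : ℝ), 0 < ε → ∃ R, ∀ X ∈ T.carrier, AgreeOnBall p.X X R →
    ‖b X p.pos - b p.X p.pos‖ < ε
  vadd : ∀ (p : VertexIn T) (z : E d), b (z +ᵥ p.X) (z + p.pos) = b p.X p.pos

theorem IsTransfer.neg {f g : Edge T 0 → E d} {b : Tiling P → E d → E d} (h : IsTransfer T f g b) :
    IsTransfer T g f (-b) where
  edge e := by
    have := h.edge e
    simp only [Pi.neg_apply]
    rw [← neg_sub (f _), ← this]
    abel
  cont p ε hε := by
    obtain ⟨R, hR⟩ := h.cont p ε hε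
    refine ⟨R, fun X hX ha => ?_⟩
    simp only [Pi.neg_apply]
    rw [← neg_sub', norm_neg]
    exact hR X hX ha
  vadd p z := congrArg Neg.neg (h.vadd p z)

theorem VertexIn.isVertex (p : VertexIn T) : p.X.IsVertex p.pos :=
  ⟨p.t, p.tile_mem, p.v, p.vertex, rfl⟩

/-- The function is the difference of vertex positions in one `f`-deformation and one
`g`-deformation of `X₀`. Using actual tilings supplies the path independence of the sums of `f - g`.
-/
theorem exists_vertexDiff {f g : Z1 T 0} (Df : Realization T f) (Dg : Realization T g)
    {X₀ : Tiling P} (hX₀ : X₀ ∈ T.carrier) :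
    ∃ b₀ : E d → E d, ∀ p q : VertexIn T, p.X = X₀ → q.X = X₀ →
      ∀ γ : EdgePath T X₀ p.pos q.pos, b₀ q.pos - b₀ p.pos = γ.eval f.1 - γ.eval g.1 := by
  classical
  obtain ⟨Y, hY⟩ := Df.realizes X₀ hX₀
  obtain ⟨Y', hY'⟩ := Dg.realizes X₀ hX₀
  obtain ⟨m⟩ := hY.nonempty_corr
  obtain ⟨m'⟩ := hY'.nonempty_corr
  have key : ∀ x, ∃ y, ∀ p : VertexIn T, p.X = X₀ → p.pos = x →
      m.vertPos p.t p.v - m'.vertPos p.t p.v = y := by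
    intro x
    by_cases h : ∃ p : VertexIn T, p.X = X₀ ∧ p.pos = x
    · obtain ⟨p, hp, hx⟩ := h
      refine ⟨m.vertPos p.t p.v - m'.vertPos p.t p.v, fun q hq hqx => ?_⟩
      rw [m.vertPos_eq (hq ▸ q.tile_mem) (hp ▸ p.tile_mem) q.vertex p.vertex (hqx.trans hx.symm),
        m'.vertPos_eq (hq ▸ q.tile_mem) (hp ▸ p.tile_mem) q.vertex p.vertex (hqx.trans hx.symm)]
    · exact ⟨0, fun p hp hx => absurd ⟨p, hp, hx⟩ h⟩
  choose b₀ hb₀ using key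
  refine ⟨b₀, fun p q hp hq γ => ?_⟩
  rw [← hb₀ _ p hp rfl, ← hb₀ _ q hq rfl,
    ← m.vertPos_sub_eval γ (hp ▸ p.tile_mem) (hq ▸ q.tile_mem) p.vertex q.vertex rfl rfl,
    ← m'.vertPos_sub_eval γ (hp ▸ p.tile_mem) (hq ▸ q.tile_mem) p.vertex q.vertex rfl rfl]
  abel

/-- `L` is the limit of `b₀ (x - z)` as `z +ᵥ X₀` tends to `X`. -/
def IsOrbitLimit (X₀ : Tiling P) (b₀ : E d → E d) (X : Tiling P) (x L : E d) : Prop :=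
  ∀ ε : ℝ, 0 < ε → ∃ R, ∀ z : E d, AgreeOnBall X (z +ᵥ X₀) R → ‖b₀ (x - z) - L‖ < ε

/-- Minimality provides translates of `X₀` that agree with `X` on the ball of radius `n`. Along them
the hypothesis is the Cauchy condition. -/
theorem exists_isOrbitLimit {X₀ X : Tiling P} (hX₀ : X₀ ∈ T.carrier) (hX : X ∈ T.carrier)
    {b₀ : E d → E d} {x : E d}
    (h : ∀ ε : ℝ, 0 < ε → ∃ R, ∀ z z' : E d, AgreeOnBall X (z +ᵥ X₀) R →
      AgreeOnBall X (z' +ᵥ X₀) R → ‖b₀ (x - z) - b₀ (x - z')‖ < ε) :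
    ∃ L, IsOrbitLimit X₀ b₀ X x L := by
  choose z hz using fun n : ℕ => T.exists_agreeOnBall hX hX₀ n
  have hcauchy : CauchySeq fun n => b₀ (x - z n) := by
    refine Metric.cauchySeq_iff.2 fun ε hε => ?_
    obtain ⟨R, hR⟩ := h ε hε
    obtain ⟨N, hN⟩ := exists_nat_ge R
    refine ⟨N, fun n hn n' hn' => ?_⟩
    rw [dist_eq_norm]
    exact hR _ _ ((hz n).mono (hN.trans (by exact_mod_cast hn)))
      ((hz n').mono (hN.trans (by exact_mod_cast hn')))
  obtain ⟨L, hL⟩ := cauchySeq_tendsto_of_complete hcauchy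
  refine ⟨L, fun ε hε => ?_⟩
  obtain ⟨R, hR⟩ := h (ε / 2) (half_pos hε)
  refine ⟨R, fun w hw => ?_⟩
  refine lt_of_le_of_lt ?_ (half_lt_self hε)
  refine le_of_tendsto (tendsto_const_nhds.sub hL).norm ?_
  obtain ⟨N, hN⟩ := exists_nat_ge R
  filter_upwards [Filter.eventually_ge_atTop N] with n hn
  exact (hR _ _ hw ((hz n).mono (hN.trans (by exact_mod_cast hn)))).le

theorem IsOrbitLimit.unique {X₀ X : Tiling P} (hX₀ : X₀ ∈ T.carrier) (hX : X ∈ T.carrier)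
    {b₀ : E d → E d} {x L L' : E d} (h : IsOrbitLimit X₀ b₀ X x L)
    (h' : IsOrbitLimit X₀ b₀ X x L') : L = L' := by
  refine eq_of_forall_dist_le fun ε hε => ?_
  obtain ⟨R, hR⟩ := h (ε / 2) (half_pos hε)
  obtain ⟨R', hR'⟩ := h' (ε / 2) (half_pos hε)
  obtain ⟨z, hz⟩ := T.exists_agreeOnBall hX hX₀ (max R R')
  have h1 := hR z (hz.mono (le_max_left _ _))
  have h2 := hR' z (hz.mono (le_max_right _ _))
  rw [← dist_eq_norm] at h1 h2
  linarith [dist_triangle_left L L' (b₀ (x - z))]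

theorem exists_isTransfer [Finite 𝒜] {f g : Z1 T 0} (Df : Realization T f) (Dg : Realization T g)
    (hfg : IsAsymptoticallyNegligible T (shapeClass T f - shapeClass T g)) :
    ∃ b, IsTransfer T f.1 g.1 b := by
  obtain ⟨k, j, c, β, hc, hβ⟩ := exists_eq_add_coboundary hfg
  obtain ⟨X₀, hX₀⟩ := T.nonempty
  obtain ⟨b₀, hb₀⟩ := exists_vertexDiff Df Dg hX₀
  have hlim : ∀ p : VertexIn T, ∃ L, IsOrbitLimit X₀ b₀ p.X p.pos L := by
    intro p
    refine exists_isOrbitLimit hX₀ p.mem fun ε hε => ?_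
    obtain ⟨R₁, hR₁⟩ := hc ε hε
    obtain ⟨R₂, hR₂⟩ := p.exists_image_move_eq j
    -- Moving the centre of the ball from the origin to `p` costs `‖p.pos‖`. The extra `1` makes the
    -- recurrence size strictly larger than `R₁`.
    refine ⟨max (R₁ + 1 + ‖p.pos‖) R₂, fun z z' hz hz' => ?_⟩
    obtain ⟨ht, hq⟩ := hR₂ X₀ hX₀ z (hz.mono (le_max_right _ _))
    obtain ⟨ht', hq'⟩ := hR₂ X₀ hX₀ z' (hz'.mono (le_max_right _ _))
    have hsize : (R₁ : ℝ≥0∞) <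
        recurrenceSize X₀ (p.move hX₀ z' ht').pos (p.move hX₀ z ht).pos := by
      have hlt : (R₁ : ℝ≥0∞) < ((R₁ + 1 : ℝ≥0) : ℝ≥0∞) := by
        exact_mod_cast lt_add_one R₁
      refine hlt.trans_le (le_iSup₂_of_le (R₁ + 1) ?_ le_rfl)
      have h1 := (hz'.symm.trans hz).vadd (r' := R₁ + 1) (-p.pos) (by
        rw [norm_neg]
        exact le_max_left _ _)
      rw [vadd_vadd, vadd_vadd] at h1
      simp only [VertexIn.move_pos, neg_sub, NNReal.coe_add, NNReal.coe_one]
      rwa [← neg_add_eq_sub, ← neg_add_eq_sub p.pos]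
    obtain ⟨γ⟩ := T.nonempty_edgePath hX₀ (p.move hX₀ z' ht').isVertex (p.move hX₀ z ht).isVertex
    have h2 := hR₁ X₀ hX₀ _ _ (p.move hX₀ z' ht').isVertex (p.move hX₀ z ht).isVertex hsize γ
    have h3 := hb₀ (p.move hX₀ z' ht') (p.move hX₀ z ht) rfl rfl γ
    -- The endpoints have the same image in `Γ^(j)`, so the `β` terms cancel and only the value of
    -- `c` on the recurrence remains.
    rw [γ.eval_sub_eval hβ _ _ rfl rfl rfl rfl, hq, hq', sub_self, add_zero] at h3
    rw [← h3] at h2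
    rwa [VertexIn.move_pos, VertexIn.move_pos] at h2
  -- The limit exists at vertices of tilings of the space; values elsewhere are arbitrary and play
  -- no role.
  let b : Tiling P → E d → E d := fun X x => Classical.epsilon (IsOrbitLimit X₀ b₀ X x)
  have hb : ∀ p : VertexIn T, IsOrbitLimit X₀ b₀ p.X p.pos (b p.X p.pos) :=
    fun p => Classical.epsilon_spec (hlim p)
  refine ⟨b, ⟨fun e => ?_, fun p ε hε => ?_, fun p z₀ => ?_⟩⟩
  -- On `X₀` the increment of `b₀` along a single edge is exactly `f - g`, which depends only on the
  -- class of the edge in `Γ^(0)`. The identity therefore passes to the limit.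
  · refine eq_of_forall_dist_le fun ε hε => ?_
    obtain ⟨R, hR⟩ := hb e.src (ε / 2) (half_pos hε)
    obtain ⟨R', hR'⟩ := hb e.tgt (ε / 2) (half_pos hε)
    obtain ⟨r, hr⟩ := exists_hitsBall P e.t
    obtain ⟨z, hz⟩ := T.exists_agreeOnBall e.mem hX₀ (max (max R R') r)
    have h1 := hR z (hz.mono ((le_max_left _ _).trans (le_max_left _ _)))
    have h2 := hR' z (hz.mono ((le_max_right _ _).trans (le_max_left _ _)))
    have ht : e.t ∈ (z +ᵥ X₀).tiles := (hz _ (hr.mono (le_max_right _ _))).1 e.tile_mem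
    let e' : EdgeIn T := ⟨X₀, hX₀, (e.t.1, -z + e.t.2), ht, e.v, e.w, e.edge⟩
    have he : Edge.mk T 0 e' = Edge.mk T 0 e := Quot.sound (Or.inl ⟨rfl, rfl, rfl⟩)
    have h3 := hb₀ e'.src e'.tgt rfl rfl (.cons (.nil _) e' rfl rfl rfl)
    have hs : e'.src.pos = e.src.pos - z := e.src.move_pos hX₀ z ht
    have ht' : e'.tgt.pos = e.tgt.pos - z := e.tgt.move_pos hX₀ z ht
    simp only [EdgePath.eval, zero_add, he, hs, ht'] at h3
    rw [← h3, dist_eq_norm]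
    calc _ = ‖(b₀ (e.src.pos - z) - b e.src.X e.src.pos) -
          (b₀ (e.tgt.pos - z) - b e.tgt.X e.tgt.pos)‖ := by
          congr 1
          change b e.X e.tgt.pos - b e.X e.src.pos - _ = b₀ _ - b e.X e.src.pos - (_ - b e.X e.tgt.pos)
          abel
      _ ≤ _ := norm_sub_le _ _
      _ ≤ ε := by linarith
  · obtain ⟨R, hR⟩ := hb p (ε / 2) (half_pos hε)
    obtain ⟨r, hr⟩ := exists_hitsBall P p.t
    refine ⟨max R r, fun X hX ha => ?_⟩
    have ht : p.t ∈ X.tiles := (ha _ (hr.mono (le_max_right _ _))).1 p.tile_mem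
    obtain ⟨R', hR'⟩ := hb ⟨X, hX, p.t, ht, p.v, p.vertex⟩ (ε / 2) (half_pos hε)
    obtain ⟨z, hz⟩ := T.exists_agreeOnBall hX hX₀ (max R R')
    have h1 := hR z ((ha.mono (le_max_left _ _)).trans (hz.mono (le_max_left _ _)))
    have h2 : ‖b₀ (p.pos - z) - b X p.pos‖ < ε / 2 := hR' z (hz.mono (le_max_right _ _))
    calc _ = ‖(b₀ (p.pos - z) - b p.X p.pos) - (b₀ (p.pos - z) - b X p.pos)‖ := by
          congr 1
          abel
      _ ≤ _ := norm_sub_le _ _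
      _ < ε := by linarith
  · let q : VertexIn T := ⟨z₀ +ᵥ p.X, T.vadd_mem _ p.mem z₀, (p.t.1, z₀ + p.t.2), by
      rw [Tiling.mem_vadd, neg_add_cancel_left]
      exact p.tile_mem, p.v, p.vertex⟩
    have hq : q.pos = z₀ + p.pos := add_assoc _ _ _
    have h1 : IsOrbitLimit X₀ b₀ (z₀ +ᵥ p.X) (z₀ + p.pos) (b (z₀ +ᵥ p.X) (z₀ + p.pos)) := by
      rw [← hq]
      exact hb q
    refine IsOrbitLimit.unique hX₀ q.mem h1 fun ε hε => ?_
    obtain ⟨R, hR⟩ := hb p ε hε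
    refine ⟨R + ‖z₀‖, fun z hz => ?_⟩
    have h2 := hz.vadd (r' := R) (-z₀) (by rw [norm_neg])
    rw [neg_vadd_vadd, vadd_vadd] at h2
    convert hR _ h2 using 4
    abel

end VertexFunction

/-! ### Matching deformed tilings and the conjugacy -/

section Conjugacy

variable {d : ℕ} {𝒜 : Type*} {P : 𝒜 → Polyhedron d} {T : TilingSpace P}

theorem IsTransfer.eval {f g : Edge T 0 → E d} {b : Tiling P → E d → E d}
    (h : IsTransfer T f g b) {X : Tiling P} {x y : E d} (γ : EdgePath T X x y) :
    b X y - b X x = γ.eval f - γ.eval g := by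
  induction γ with
  | nil => simp [EdgePath.eval]
  | cons γ e hX hsrc htgt ih =>
    have h1 := h.edge e
    rw [hX, hsrc, htgt] at h1
    simp only [EdgePath.eval]
    calc _ = (b X _ - b X _) + (b X _ - b X _) := (sub_add_sub_cancel _ _ _).symm
      _ = _ := by rw [h1, ih]; abel

theorem Tiling.exists_vertexIn {X : Tiling P} (hX : X ∈ T.carrier) : ∃ p : VertexIn T, p.X = X := by
  obtain ⟨t, ht, -⟩ := X.cover 0
  obtain ⟨v, -, hv⟩ := (P t.1).exists_vertex (P t.1).body_mem
  exact ⟨⟨X, hX, t, ht, v, hv⟩, rfl⟩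

variable {f g : Z1 T 0}

/-- `Y` and `Y'` are deformations of the same tiling of the space, and the differences between the
positions of corresponding vertices are given by `b`. -/
def Matched (Df : Realization T f) (Dg : Realization T g) (b : Tiling P → E d → E d)
    (Y : Tiling Df.proto) (Y' : Tiling Dg.proto) : Prop :=
  ∃ X ∈ T.carrier, ∃ (m : Corr Df.cellIso X Y) (m' : Corr Dg.cellIso X Y'),
    ∀ p : VertexIn T, p.X = X → m.vertPos p.t p.v - m'.vertPos p.t p.v = b X p.pos

variable {Df : Realization T f} {Dg : Realization T g} {b : Tiling P → E d → E d}

namespace Matched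

variable {Y : Tiling Df.proto} {Y' : Tiling Dg.proto}

theorem symm (h : Matched Df Dg b Y Y') : Matched Dg Df (-b) Y' Y := by
  obtain ⟨X, hX, m, m', hm⟩ := h
  refine ⟨X, hX, m', m, fun p hp => ?_⟩
  rw [← neg_sub, hm p hp]
  rfl

theorem vadd (h : Matched Df Dg b Y Y') (z : E d) : Matched Df Dg b (z +ᵥ Y) (z +ᵥ Y') := by
  obtain ⟨X, hX, m, m', hm⟩ := h
  refine ⟨X, hX, m.vaddRight z, m'.vaddRight z, fun p hp => ?_⟩
  rw [← hm p hp]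
  simp only [Corr.vertPos, Corr.vaddRight]
  abel

theorem mem_space (h : Matched Df Dg b Y Y') : Y' ∈ Dg.space := by
  obtain ⟨X, hX, -, m', -⟩ := h
  exact ⟨X, hX, m'.sameCombinatorics⟩

end Matched

/-- Translate any `g`-deformation so that the relation holds at one vertex. Along edge paths both
sides change by the sum of `f - g`, so it holds at every vertex. -/
theorem exists_matched [Finite 𝒜] (hb : IsTransfer T f.1 g.1 b) {Y : Tiling Df.proto}
    (hY : Y ∈ Df.space) : ∃ Y', Matched Df Dg b Y Y' := by
  obtain ⟨X, hX, hXY⟩ := hY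
  obtain ⟨m⟩ := hXY.nonempty_corr
  obtain ⟨Y', hY'⟩ := Dg.realizes X hX
  obtain ⟨m'⟩ := hY'.nonempty_corr
  obtain ⟨p, rfl⟩ := Tiling.exists_vertexIn hX
  set u := m.vertPos p.t p.v - m'.vertPos p.t p.v - b p.X p.pos with hu
  refine ⟨u +ᵥ Y', p.X, hX, m, m'.vaddRight u, fun q hq => ?_⟩
  have hqt : q.t ∈ p.X.tiles := hq ▸ q.tile_mem
  obtain ⟨γ⟩ := T.nonempty_edgePath hX p.isVertex (hq ▸ q.isVertex)
  have h1 := m.vertPos_sub_eval γ p.tile_mem hqt p.vertex q.vertex rfl rfl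
  have h2 := m'.vertPos_sub_eval γ p.tile_mem hqt p.vertex q.vertex rfl rfl
  have h3 := hb.eval γ
  have h4 : (m'.vaddRight u).vertPos q.t q.v = u + m'.vertPos q.t q.v := add_assoc _ _ _
  rw [h4, hu]
  rw [← h1, ← h2, sub_eq_iff_eq_add] at h3
  rw [h3]
  abel

/-- If `Y` is close to `Y₂`, then the tiling matched to `Y` is close to the one matched to `Y₂`. -/
theorem Matched.exists_patchSubset [Finite 𝒜] (hb : IsTransfer T f.1 g.1 b) {Y : Tiling Df.proto}
    {Y' : Tiling Dg.proto} (h : Matched Df Dg b Y Y') {ε : ℝ} (hε : 0 < ε) (R' : ℝ) :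
    ∃ R, ∀ (Y₂ : Tiling Df.proto) (Y₂' : Tiling Dg.proto), Matched Df Dg b Y₂ Y₂' →
      PatchSubset Y Y₂ R → ∃ w : E d, ‖w‖ < ε ∧ PatchSubset Y' (w +ᵥ Y₂') R' := by
  obtain ⟨X, hX, m, m', hm⟩ := h
  obtain ⟨p, rfl⟩ := Tiling.exists_vertexIn hX
  obtain ⟨R₁, hR₁⟩ := m'.exists_patchSubset p.tile_mem R'
  obtain ⟨R₂, hR₂⟩ := hb.cont p ε hε
  -- Read from `Y` back to `X`: a large patch of `Y` fixes a large patch of `X` up to translation.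
  -- That patch must be large enough both to fix a patch of `Y'` and to make `b` vary little; the
  -- `1` is lost in passing from `PatchSubset` to `AgreeOnBall`.
  obtain ⟨R, hR⟩ := m.symm.exists_patchSubset (m.map_mem _ p.tile_mem) (max R₁ (R₂ + 1))
  refine ⟨R, fun Y₂ Y₂' ⟨X₃, hX₃, m₃, m₃', hm₃⟩ hYY => ?_⟩
  obtain ⟨hy, hsub⟩ := hR Y₂ X₃ m₃.symm hYY
  set z := m.symm.toFun (p.t.1, m.toFun p.t) - m₃.symm.toFun (p.t.1, m.toFun p.t) with hz
  have hz' : z = p.t.2 - m₃.invFun (p.t.1, m.toFun p.t) := by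
    rw [hz]
    exact congrArg (· - _) (m.left_inv p.t p.tile_mem)
  obtain ⟨ht, hsub'⟩ := hR₁ _ _ (m₃'.vaddLeft z) (hsub.mono (le_max_left _ _))
  refine ⟨_, ?_, hsub'⟩
  have hagree := (hsub.mono (le_max_right _ _)).agreeOnBall (lt_add_one R₂)
  have hsmall := hR₂ _ (T.vadd_mem _ hX₃ z) hagree
  let q : VertexIn T := ⟨X₃, hX₃, (p.t.1, -z + p.t.2), ht, p.v, p.vertex⟩
  have hpos : z + q.pos = p.pos := by
    simp only [q, VertexIn.pos]
    abel
  have hbq : b (z +ᵥ X₃) p.pos = b X₃ q.pos := by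
    rw [← hpos]
    exact hb.vadd q z
  have h1 := hm p rfl
  have h2 := hm₃ q rfl
  -- The chosen tile has exactly the same place in `Y` and in `Y₂`. The `f`-positions cancel, and
  -- the shift between the `g`-tilings equals the change of `b`.
  have h3 : m₃.toFun (p.t.1, -z + p.t.2) = m.toFun p.t := by
    have h4 : -z + p.t.2 = m₃.invFun (p.t.1, m.toFun p.t) := by
      rw [hz']
      abel
    rw [h4]
    exact m₃.right_inv _ hy
  rw [hbq, ← h1, ← h2] at hsmall
  convert hsmall using 2
  simp only [Corr.vertPos, Corr.vaddLeft, q, h3]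
  abel

theorem Matched.exists_close [Finite 𝒜] (hb : IsTransfer T f.1 g.1 b) {Y : Tiling Df.proto}
    {Y' : Tiling Dg.proto} (h : Matched Df Dg b Y Y') {ε : ℝ} (hε : 0 < ε) :
    ∃ δ > 0, ∀ (Y₂ : Tiling Df.proto) (Y₂' : Tiling Dg.proto), Matched Df Dg b Y₂ Y₂' →
      Close δ Y Y₂ → Close ε Y' Y₂' := by
  -- Radius `1 / ε` is wanted in the end, `ε` pays for the translation by `u - w`, and `1` for the
  -- passage to `AgreeOnBall`.
  obtain ⟨R, hR⟩ := h.exists_patchSubset hb (half_pos hε) (1 / ε + ε + 1)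
  obtain ⟨δ, hδ, hδε, hδR⟩ := exists_pos_le_one_div_sub R (ε / 2) (half_pos hε)
  refine ⟨δ, hδ, fun Y₂ Y₂' h₂ hc => ?_⟩
  obtain ⟨u, hu, ha⟩ := hc.exists_agreeOnBall
  obtain ⟨w, hw, hsub⟩ := hR _ _ (h₂.vadd (-u)) (ha.patchSubset.mono hδR)
  have hnorm : ‖u - w‖ < ε := by linarith [norm_sub_le u w]
  have h1 := (hsub.agreeOnBall (lt_add_one _)).vadd (r' := 1 / ε) (u - w) (by linarith)
  refine ⟨u - w, hnorm, ?_⟩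
  convert h1 using 1
  rw [vadd_vadd, vadd_vadd, sub_add_cancel, add_neg_cancel, zero_vadd]

/-- The tiling `X` behind `Y` is not determined by `Y`; translates of `X` serve equally well.
Continuity applied to `Y` and itself shows that this choice does not affect the partner. -/
theorem Matched.unique [Finite 𝒜] (hb : IsTransfer T f.1 g.1 b) {Y : Tiling Df.proto}
    {Y' Y'' : Tiling Dg.proto} (h : Matched Df Dg b Y Y') (h' : Matched Df Dg b Y Y'') :
    Y' = Y'' := by
  refine eq_of_forall_close fun ε hε => ?_
  obtain ⟨δ, hδ, hclose⟩ := h.exists_close hb hε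
  exact hclose Y Y'' h' (Close.refl hδ Y)

theorem continuous_of_matched [Finite 𝒜] (hb : IsTransfer T f.1 g.1 b) {φ : Df.space → Dg.space}
    (hφ : ∀ Y, Matched Df Dg b Y.1 (φ Y).1) : Continuous φ := by
  refine Continuous.subtype_mk (f := fun Y => (φ Y).1) ?_ fun Y => (φ Y).2
  refine continuous_iff_continuousAt.2 fun Y U hU => ?_
  obtain ⟨ε, hε, hU⟩ := mem_nhds_iff_close.1 hU
  obtain ⟨δ, hδ, hclose⟩ := (hφ Y).exists_close hb hε
  have hV : {Z | Close δ Y.1 Z} ∈ nhds Y.1 := mem_nhds_iff_close.2 ⟨δ, hδ, fun _ h => h⟩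
  rw [Filter.mem_map]
  filter_upwards [continuous_subtype_val.continuousAt.preimage_mem_nhds hV] with Z hZ
  exact hU _ (hclose _ _ (hφ Z) hZ)

/-- The relation `Matched` is symmetric up to the sign of `b` and invariant under translation.
Uniqueness of partners then turns these facts into the inverse laws and equivariance. -/
theorem exists_homeomorph_of_isTransfer [Finite 𝒜] (Df : Realization T f) (Dg : Realization T g)
    (hb : IsTransfer T f.1 g.1 b) :
    ∃ φ : Df.space ≃ₜ Dg.space, ∀ (z : E d) (Y : Df.space), φ (z +ᵥ Y) = z +ᵥ φ Y := by
  choose F hF using fun Y : Df.space => exists_matched (Dg := Dg) hb Y.2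
  choose G hG using fun Y : Dg.space => exists_matched (Dg := Df) hb.neg Y.2
  let φ : Df.space → Dg.space := fun Y => ⟨F Y, (hF Y).mem_space⟩
  let ψ : Dg.space → Df.space := fun Y => ⟨G Y, (hG Y).mem_space⟩
  have hG' : ∀ Y : Dg.space, Matched Df Dg b (G Y) Y := fun Y => by
    simpa only [neg_neg] using (hG Y).symm
  refine ⟨{
    toFun := φ
    invFun := ψ
    left_inv := fun Y => Subtype.ext ((hG (φ Y)).unique hb.neg (hF Y).symm)
    right_inv := fun Y => Subtype.ext ((hF (ψ Y)).unique hb (hG' Y))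
    continuous_toFun := continuous_of_matched hb hF
    continuous_invFun := continuous_of_matched hb.neg hG }, fun z Y => ?_⟩
  exact Subtype.ext ((hF (z +ᵥ Y)).unique hb ((hF Y).vadd z))

end Conjugacy

end TilingDeformation

open TilingDeformation in
theorem theorem2p2 {d : ℕ} {𝒜 : Type*} [Finite 𝒜] (P : 𝒜 → Polyhedron d) (T : TilingSpace P)
    (f g : Z1 T 0) (Df : Realization T f) (Dg : Realization T g)
    (hfg : IsAsymptoticallyNegligible T (shapeClass T f - shapeClass T g)) :
    ∃ φ : Df.space ≃ₜ Dg.space, ∀ (z : E d) (Y : Df.space), φ (z +ᵥ Y) = z +ᵥ φ Y := by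
  obtain ⟨b, hb⟩ := exists_isTransfer Df Dg hfg
  exact exists_homeomorph_of_isTransfer Df Dg hb
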